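/- Let $\mathcal H=\mathcal H_+\oplus\mathcal H_-$ be an orthogonal decomposition of a complex Hilbert space into infinite-dimensional closed subspaces, let $P_+$ be the orthogonal projection onto $\mathcal H_+$, and write $L^2(E,F)$ for the Hilbert--Schmidt operators $E\to F$ with the Hilbert--Schmidt norm $\|\cdot\|_2$. The restricted Grassmannian $\mathrm{Gr}_{\rm res}$ is the set of closed subspaces $W\subset\mathcal H$ such that the orthogonal projection $W\to\mathcal H_+$ is Fredholm and the orthogonal projection $W\to\mathcal H_-$ is Hilbert--Schmidt; a closed subspace $W$ is identified with the orthogonal projection $P_W$ onto it. $\mathrm{Gr}_{\rm res}$ carries the topology and the smooth structure given by the charts $\phi_W(V)=P_{W^\perp}(P_W|_V)^{-1}\in L^2(W,W^\perp)$, $W\in\mathrm{Gr}_{\rm res}$, defined for those $V\in\mathrm{Gr}_{\rm res}$ with $V\oplus W^\perp=\mathcal H$ (a not necessarily orthogonal direct sum). Let $U_{\rm res}$ be the group of unitary operators $g$ on $\mathcal H$ with $[g,P_+]\in L^2(\mathcal H,\mathcal H)$, with the smooth structure as a submanifold of the Banach space of bounded operators $x$ with $[x,P_+]\in L^2(\mathcal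 H,\mathcal H)$, normed by $\max(\|x\|,\|[x,P_+]\|_2)$. Let $U_+$ be the unitary group of $\mathcal H_+$, with the smooth structure as a submanifold of the bounded operators on $\mathcal H_+$ with the operator norm, and $\mathfrak u_+$ the real Banach space of bounded skew-adjoint operators on $\mathcal H_+$. Let $\mathfrak U_{\rm res}$ be the set of partial isometries $u$ on $\mathcal H$ with $u^*u,uu^*\in\mathrm{Gr}_{\rm res}$. Let $(V_\alpha,\psi_\alpha)_\alpha$, $\psi_\alpha:V_\alpha\to\mathfrak u_+$, be a smooth atlas of $U_+$. Let $(\Omega_\beta)_\beta$ be an open cover of $\mathrm{Gr}_{\rm res}$ and $W_\beta\in\Omega_\beta$ points such that $\Omega_\beta$ is contained in the domain of $\phi_{W_\beta}$; put $\tilde\psi_\beta=\phi_{W_\beta}|_{\Omega_\beta}$. Let $\sigma_\beta:\Omega_\beta\to U_{\rm res}$ be smooth maps with $V=\sigma_\beta(V)\mathcal H_+$ for all $V\in\Omega_\beta$. Define $$\Omega_{\alpha\beta\gamma}=\{u\in\mathfrak U_{\rm res}: u^*u\in\Omega_\beta,\ uu^*\in\Omega_\gamma,\ (\sigma_\gamma(uu^*)^{-1}u\,\sigma_\beta(u^*u))|_{\mathcal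 H_+}\in V_\alpha\},$$ $$\Phi_{\alpha\beta\gamma}(u)=\big(\tilde\psi_\gamma(uu^*),\ \tilde\psi_\beta(u^*u),\ \psi_\alpha\big((\sigma_\gamma(uu^*)^{-1}u\,\sigma_\beta(u^*u))|_{\mathcal H_+}\big)\big).$$ Then the maps $\Phi_{\alpha\beta\gamma}:\Omega_{\alpha\beta\gamma}\to L^2(W_\gamma,W_\gamma^\perp)\times L^2(W_\beta,W_\beta^\perp)\times\mathfrak u_+$ are well defined (that is, $\tilde\psi_\beta$ takes values in $L^2(W_\beta,W_\beta^\perp)$, and $(\sigma_\gamma(uu^*)^{-1}u\,\sigma_\beta(u^*u))|_{\mathcal H_+}\in U_+$ whenever $u^*u\in\Omega_\beta$ and $uu^*\in\Omega_\gamma$), and they form a smooth atlas on $\mathfrak U_{\rm res}$: the sets $\Omega_{\alpha\beta\gamma}$ cover $\mathfrak U_{\rm res}$, each $\Phi_{\alpha\beta\gamma}$ is injective, the images of $\Omega_{\alpha\beta\gamma}$ and of the overlaps $\Omega_{\alpha\beta\gamma}\cap\Omega_{\alpha'\beta'\gamma'}$ under $\Phi_{\alpha\beta\gamma}$ are open,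 and all transition maps are (real) smooth. The model spaces are Banach spaces and the topology defined by the atlas is Hausdorff, so $\mathfrak U_{\rm res}$ becomes a smooth (Hausdorff) Banach manifold modelled on the Banach spaces $L^2(W_\gamma,W_\gamma^\perp)\times L^2(W_\beta,W_\beta^\perp)\times\mathfrak u_+$. -/

import Mathlib

open Set Topology
open scoped ContDiff InnerProductSpace

/-! ### Smooth atlases on a set, with model Banach spaces that may depend on the chart -/

section Atlas

variable {M ι : Type*} {E : ι → Type*} [∀ i, NormedAddCommGroup (E i)] [∀ i, NormedSpace ℝ (E i)]

/-- The family of charts `φ i : dom i → E i` (only the values of `φ i` on `dom i` matter) is a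
smooth atlas on the set `M`: the domains cover `M`, every chart is injective, the images of the
overlaps (in particular the images of the charts) are open, and the transition maps
`φ j ∘ (φ i)⁻¹ : φ i (dom i ∩ dom j) → φ j (dom i ∩ dom j)` are smooth. -/
structure IsSmoothAtlas (dom : ι → Set M) (φ : ∀ i, M → E i) : Prop where
  cover : ⋃ i, dom i = univ
  injOn : ∀ i, InjOn (φ i) (dom i)
  isOpen_image : ∀ i j, IsOpen (φ i '' (dom i ∩ dom j))
  smooth_transition : ∀ i j, ∃ g : E i → E j, ContDiffOn ℝ ∞ g (φ i '' (dom i ∩ dom j)) ∧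
    ∀ x ∈ dom i ∩ dom j, g (φ i x) = φ j x

/-- The manifold topology of an atlas: it is generated by the preimages under the charts of the
open subsets of the model spaces. -/
@[reducible]
def atlasTopology (dom : ι → Set M) (φ : ∀ i, M → E i) : TopologicalSpace M :=
  TopologicalSpace.generateFrom {s | ∃ i, ∃ O : Set (E i), IsOpen O ∧ s = dom i ∩ φ i ⁻¹' O}

/-- A map `f : s → F` from a subset `s` of a manifold (with atlas `dom`, `φ`) to a normed space is
smooth if all its coordinate expressions `f ∘ (φ i)⁻¹ : φ i (s ∩ dom i) → F` are. -/
def SmoothOnAtlas (dom : ι → Set M) (φ : ∀ i, M → E i) {F : Type*} [NormedAddCommGroup F]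
    [NormedSpace ℝ F] (f : M → F) (s : Set M) : Prop :=
  ∀ i, ∃ g : E i → F, ContDiffOn ℝ ∞ g (φ i '' (s ∩ dom i)) ∧ ∀ x ∈ s ∩ dom i, g (φ i x) = f x

end Atlas

noncomputable section

/-! ### Hilbert–Schmidt operators -/

section HilbertSchmidt

variable (E F : Type*) [NormedAddCommGroup E] [InnerProductSpace ℂ E] [CompleteSpace E]
  [NormedAddCommGroup F] [InnerProductSpace ℂ F]

/-- The index set of a chosen orthonormal (Hilbert) basis of `E`. -/
def hsIndex : Set E := (exists_hilbertBasis ℂ E).choose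

/-- A chosen orthonormal (Hilbert) basis of `E`. -/
def hsBasis : HilbertBasis (hsIndex E) ℂ E := (exists_hilbertBasis ℂ E).choose_spec.choose

variable {E F}

/-- `A` is Hilbert–Schmidt: `∑ ‖A eᵢ‖² < ∞` for an orthonormal basis `(eᵢ)`. The choice of the
basis is irrelevant, see `isHilbertSchmidt_iff`. -/
def IsHilbertSchmidt (A : E →L[ℂ] F) : Prop :=
  Summable fun i => ‖A (hsBasis E i)‖ ^ 2

theorem isHilbertSchmidt_iff_memℓp (A : E →L[ℂ] F) :
    IsHilbertSchmidt A ↔ Memℓp (fun i => A (hsBasis E i)) 2 := by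
  rw [memℓp_gen_iff (by norm_num)]
  simp [IsHilbertSchmidt]

theorem HilbertBasis.tsum_enorm_inner_sq {G ι : Type*} [NormedAddCommGroup G]
    [InnerProductSpace ℂ G] (b : HilbertBasis ι ℂ G) (x : G) :
    ∑' i, ‖⟪b i, x⟫_ℂ‖ₑ ^ 2 = ‖x‖ₑ ^ 2 := by
  have h := lp.hasSum_norm (p := 2) (by norm_num) (b.repr x)
  simp only [b.repr_apply_apply, LinearIsometryEquiv.norm_map, ENNReal.toReal_ofNat,
    Real.rpow_ofNat] at h
  have h2 := ENNReal.ofReal_tsum_of_nonneg (fun i => by positivity) h.summable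
  rw [h.tsum_eq] at h2
  simpa [ENNReal.ofReal_pow, ofReal_norm] using h2.symm

theorem tsum_enorm_sq_eq_adjoint [CompleteSpace F] {ι κ : Type*} (b : HilbertBasis ι ℂ E)
    (c : HilbertBasis κ ℂ F) (A : E →L[ℂ] F) :
    ∑' i, ‖A (b i)‖ₑ ^ 2 = ∑' j, ‖ContinuousLinearMap.adjoint A (c j)‖ₑ ^ 2 := by
  have h1 : ∀ i, ‖A (b i)‖ₑ ^ 2 = ∑' j, ‖⟪c j, A (b i)⟫_ℂ‖ₑ ^ 2 :=
    fun i => (c.tsum_enorm_inner_sq _).symm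
  have h2 : ∀ j, ‖ContinuousLinearMap.adjoint A (c j)‖ₑ ^ 2 =
      ∑' i, ‖⟪b i, ContinuousLinearMap.adjoint A (c j)⟫_ℂ‖ₑ ^ 2 :=
    fun j => (b.tsum_enorm_inner_sq _).symm
  simp_rw [h1, h2]
  rw [ENNReal.tsum_comm]
  refine tsum_congr fun j => tsum_congr fun i => ?_
  rw [ContinuousLinearMap.adjoint_inner_right, ← inner_conj_symm, ← ofReal_norm, ← ofReal_norm,
    RCLike.norm_conj]

/-- `∑ ‖A eᵢ‖²` is the same for all orthonormal bases. -/
theorem tsum_enorm_sq_basis_indep [CompleteSpace F] {ι : Type*} (b : HilbertBasis ι ℂ E)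
    (A : E →L[ℂ] F) : ∑' i, ‖A (b i)‖ₑ ^ 2 = ∑' i, ‖A (hsBasis E i)‖ₑ ^ 2 := by
  rw [tsum_enorm_sq_eq_adjoint b (hsBasis F), tsum_enorm_sq_eq_adjoint (hsBasis E) (hsBasis F)]

theorem summable_norm_sq_iff {G ι : Type*} [NormedAddCommGroup G] (f : ι → G) :
    (Summable fun i => ‖f i‖ ^ 2) ↔ ∑' i, ‖f i‖ₑ ^ 2 ≠ ⊤ := by
  have h : ∀ i, ‖f i‖ₑ ^ 2 = ((‖f i‖₊ ^ 2 : NNReal) : ENNReal) := fun i => by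
    rw [ENNReal.coe_pow]; rfl
  simp_rw [h, ENNReal.tsum_coe_ne_top_iff_summable, ← NNReal.summable_coe]
  simp

theorem isHilbertSchmidt_iff [CompleteSpace F] {ι : Type*} (b : HilbertBasis ι ℂ E)
    (A : E →L[ℂ] F) : IsHilbertSchmidt A ↔ Summable fun i => ‖A (b i)‖ ^ 2 := by
  rw [IsHilbertSchmidt, summable_norm_sq_iff, summable_norm_sq_iff, tsum_enorm_sq_basis_indep b]

variable (E F)

/-- The Hilbert–Schmidt operators as a linear subspace of the bounded operators. -/
def hsSubmodule : Submodule ℂ (E →L[ℂ] F) where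
  carrier := {A | IsHilbertSchmidt A}
  add_mem' {A B} hA hB := by
    simp only [Set.mem_ofPred_eq, isHilbertSchmidt_iff_memℓp] at *
    exact hA.add hB
  zero_mem' := by simp [IsHilbertSchmidt]
  smul_mem' c A hA := by
    simp only [Set.mem_ofPred_eq, isHilbertSchmidt_iff_memℓp] at *
    exact hA.const_smul c

/-- The space `L²(E, F)` of Hilbert–Schmidt operators; it carries the Hilbert–Schmidt norm. -/
def HS : Type _ := ↥(hsSubmodule E F)

namespace HS

instance : AddCommGroup (HS E F) := inferInstanceAs (AddCommGroup ↥(hsSubmodule E F))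

instance : Module ℂ (HS E F) := inferInstanceAs (Module ℂ ↥(hsSubmodule E F))

variable {E F}

/-- The Hilbert–Schmidt operator defined by a bounded operator with the Hilbert–Schmidt
property. -/
def mk (A : E →L[ℂ] F) (hA : IsHilbertSchmidt A) : HS E F := (⟨A, hA⟩ : ↥(hsSubmodule E F))

/-- A Hilbert–Schmidt operator as a bounded operator. -/
def toCLM (A : HS E F) : E →L[ℂ] F := Subtype.val (p := (· ∈ hsSubmodule E F)) A

variable (E F)

/-- The map `A ↦ (A eᵢ)ᵢ` for the chosen orthonormal basis `(eᵢ)`. -/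
def toLp : HS E F →ₗ[ℂ] lp (fun _ : hsIndex E => F) 2 where
  toFun A := ⟨fun i => A.toCLM (hsBasis E i), (isHilbertSchmidt_iff_memℓp _).1 A.2⟩
  map_add' _ _ := rfl
  map_smul' _ _ := rfl

theorem toLp_injective : Function.Injective (toLp E F) := by
  intro A B h
  refine Subtype.ext (ContinuousLinearMap.ext_on
    ((Submodule.dense_iff_topologicalClosure_eq_top).2 (hsBasis E).dense_span) ?_)
  rintro _ ⟨i, rfl⟩
  exact congrFun (congrArg Subtype.val h) i

/-- The Hilbert–Schmidt norm `‖A‖₂ = (∑ ‖A eᵢ‖²)^(1/2)`, see `HS.norm_sq_eq`. -/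
instance : NormedAddCommGroup (HS E F) :=
  NormedAddCommGroup.induced (HS E F) (lp (fun _ : hsIndex E => F) 2) (toLp E F)
    (toLp_injective E F)

instance : NormedSpace ℂ (HS E F) :=
  NormedSpace.induced ℂ (HS E F) (lp (fun _ : hsIndex E => F) 2) (toLp E F)

theorem norm_sq_eq (A : HS E F) : ‖A‖ ^ 2 = ∑' i, ‖A.toCLM (hsBasis E i)‖ ^ 2 := by
  have h := lp.norm_rpow_eq_tsum (p := 2) (by norm_num) (toLp E F A)
  simp only [ENNReal.toReal_ofNat, Real.rpow_ofNat] at h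
  exact h

end HS

end HilbertSchmidt

/-! ### The restricted Grassmannian and the restricted unitary group -/

variable {H : Type*} [NormedAddCommGroup H] [InnerProductSpace ℂ H] [CompleteSpace H]

section Restricted

variable (Hp : Submodule ℂ H) [CompleteSpace Hp]

/-- The restricted Grassmannian of the polarization `H = Hp ⊕ Hpᗮ`: the closed (equivalently,
complete) subspaces `W` of `H` for which the orthogonal projection `W → Hp` is Fredholm and the
orthogonal projection `W → Hpᗮ` is Hilbert–Schmidt. -/
structure GrRes where
  space : Submodule ℂ H
  complete : CompleteSpace space
  fredholm : (Hp.orthogonalProjectionOnto ∘L space.subtypeL).IsFredholm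
  hilbertSchmidt : IsHilbertSchmidt (Hpᗮ.orthogonalProjectionOnto ∘L space.subtypeL)

attribute [instance] GrRes.complete

/-- The space `L_res` of bounded operators `x` on `H` with `[x, P₊]` Hilbert–Schmidt, as a linear
subspace. -/
def resSubmodule : Submodule ℂ (H →L[ℂ] H) :=
  (hsSubmodule H H).comap
    (LinearMap.mulRight ℂ Hp.starProjection - LinearMap.mulLeft ℂ Hp.starProjection)

theorem mem_resSubmodule (x : H →L[ℂ] H) : x ∈ resSubmodule Hp ↔
    IsHilbertSchmidt (x * Hp.starProjection - Hp.starProjection * x) := Iff.rfl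

/-- The space `L_res` with its own norm `max (‖x‖, ‖[x, P₊]‖₂)`. -/
def LRes : Type _ := ↥(resSubmodule Hp)

namespace LRes

instance : AddCommGroup (LRes Hp) := inferInstanceAs (AddCommGroup ↥(resSubmodule Hp))

instance : Module ℂ (LRes Hp) := inferInstanceAs (Module ℂ ↥(resSubmodule Hp))

variable {Hp}

/-- An element of `L_res` as a bounded operator. -/
def toCLM (x : LRes Hp) : H →L[ℂ] H := Subtype.val (p := (· ∈ resSubmodule Hp)) x

/-- The commutator `[x, P₊]` as a Hilbert–Schmidt operator. -/
def comm (x : LRes Hp) : HS H H :=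
  HS.mk (x.toCLM * Hp.starProjection - Hp.starProjection * x.toCLM) x.2

variable (Hp)

/-- The map `x ↦ (x, [x, P₊])`. -/
def toProd : LRes Hp →ₗ[ℂ] (H →L[ℂ] H) × HS H H where
  toFun x := (x.toCLM, x.comm)
  map_add' x y := Prod.ext rfl (Subtype.ext
    (map_add (LinearMap.mulRight ℂ Hp.starProjection - LinearMap.mulLeft ℂ Hp.starProjection)
      x.toCLM y.toCLM))
  map_smul' c x := Prod.ext rfl (Subtype.ext
    (map_smul (LinearMap.mulRight ℂ Hp.starProjection - LinearMap.mulLeft ℂ Hp.starProjection)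
      c x.toCLM))

theorem toProd_injective : Function.Injective (toProd Hp) :=
  fun _ _ h => Subtype.ext (congrArg Prod.fst h)

instance : NormedAddCommGroup (LRes Hp) :=
  NormedAddCommGroup.induced (LRes Hp) ((H →L[ℂ] H) × HS H H) (toProd Hp) (toProd_injective Hp)

instance : NormedSpace ℂ (LRes Hp) :=
  NormedSpace.induced ℂ (LRes Hp) ((H →L[ℂ] H) × HS H H) (toProd Hp)

end LRes

/-- The restricted unitary group: the unitary operators `u` on `H` with `[u, P₊]` Hilbert–Schmidt.
As a Banach Lie group it is a submanifold of the Banach space `L_res`. -/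
def URes : Type _ := {x : LRes Hp // x.toCLM ∈ unitary (H →L[ℂ] H)}

namespace URes

variable {Hp}

/-- An element of `U_res` as an element of `L_res`. -/
def toLRes (g : URes Hp) : LRes Hp := g.1

/-- An element of `U_res` as a unitary operator on `H`. -/
def toUnitary (g : URes Hp) : unitary (H →L[ℂ] H) := ⟨g.1.toCLM, g.2⟩

end URes

/-- The partial isometries `u` on `H` with `u* u` and `u u*` in the restricted Grassmannian (whose
elements are identified with the orthogonal projections onto them). -/
def PartIsoRes : Type _ :=
  {u : H →L[ℂ] H // IsStarProjection (star u * u) ∧ IsStarProjection (u * star u) ∧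
    (∃ W : GrRes Hp, W.space.starProjection = star u * u) ∧
    (∃ W : GrRes Hp, W.space.starProjection = u * star u)}

variable {Hp}

namespace PartIsoRes

/-- The source `u* u`, as an element of the restricted Grassmannian. -/
def source (u : PartIsoRes Hp) : GrRes Hp := u.2.2.2.1.choose

/-- The target `u u*`, as an element of the restricted Grassmannian. -/
def target (u : PartIsoRes Hp) : GrRes Hp := u.2.2.2.2.choose

theorem starProjection_source (u : PartIsoRes Hp) :
    u.source.space.starProjection = star u.1 * u.1 := u.2.2.2.1.choose_spec

theorem starProjection_target (u : PartIsoRes Hp) :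
    u.target.space.starProjection = u.1 * star u.1 := u.2.2.2.2.choose_spec

end PartIsoRes

/-! ### Charts of the restricted Grassmannian -/

/-- The domain of the chart at `W`: all `V` with `V ⊕ Wᗮ = H` (not necessarily orthogonally). -/
def grDom (W : GrRes Hp) : Set (GrRes Hp) := {V | IsCompl V.space W.spaceᗮ}

/-- The operator `P_{Wᗮ} (P_W|_V)⁻¹ : W → Wᗮ`. For `V` in `grDom W` its graph is `V`. -/
def grChartOp (W V : GrRes Hp) : W.space →L[ℂ] W.spaceᗮ :=
  (W.spaceᗮ.orthogonalProjectionOnto ∘L V.space.subtypeL) ∘L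
    (W.space.orthogonalProjectionOnto ∘L V.space.subtypeL).inverse

open Classical in
/-- The chart at `W`, with values in `L²(W, Wᗮ)` (on `grDom W` the operator is always
Hilbert–Schmidt; outside of it the value is irrelevant). -/
def grChart (W V : GrRes Hp) : HS W.space W.spaceᗮ :=
  if h : IsHilbertSchmidt (grChartOp W V) then HS.mk (grChartOp W V) h else 0

variable (Hp) in
/-- The manifold topology of the restricted Grassmannian. -/
@[reducible]
def grTopology : TopologicalSpace (GrRes Hp) :=
  atlasTopology (E := fun W : GrRes Hp => HS W.space W.spaceᗮ) grDom grChart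

/-- `σ` is a smooth local cross-section over `Ω`: a smooth map `Ω → U_res` such that
`V = σ(V) Hp` for `V` in `Ω`. -/
structure IsSmoothCrossSection (Ω : Set (GrRes Hp)) (σ : GrRes Hp → URes Hp) : Prop where
  smooth : SmoothOnAtlas (E := fun W : GrRes Hp => HS W.space W.spaceᗮ) grDom grChart
    (fun V => (σ V).toLRes) Ω
  map_eq : ∀ V ∈ Ω, Hp.map ((σ V).toLRes.toCLM : H →ₗ[ℂ] H) = V.space

end Restricted

/-! ### Charts of the unitary group -/

section UnitaryGroup

variable (K : Type*) [NormedAddCommGroup K] [InnerProductSpace ℂ K] [CompleteSpace K]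

/-- The unitary group of the Hilbert space `K`, with the norm topology. -/
abbrev UGroup : Type _ := ↥(unitary (K →L[ℂ] K))

/-- The real Banach space of skew-adjoint bounded operators on `K`. -/
abbrev UAlg : Type _ := ↥(skewAdjoint.submodule ℝ (K →L[ℂ] K))

variable {K}

/-- A smooth chart of the unitary group, a closed submanifold of the real Banach space of bounded
operators: a homeomorphism `e` from an open set of unitaries onto an open set of skew-adjoint
operators, such that `e⁻¹` is smooth as an operator-valued map and `e` is locally the restriction
of a smooth map defined on an open set of operators. -/
structure IsSmoothUnitaryChart (e : OpenPartialHomeomorph (UGroup K) (UAlg K)) : Prop where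
  smooth_symm : ContDiffOn ℝ ∞ (fun X => (e.symm X : K →L[ℂ] K)) e.target
  smooth : ∀ g ∈ e.source, ∃ N : Set (K →L[ℂ] K), IsOpen N ∧ (g : K →L[ℂ] K) ∈ N ∧
    ∃ f : (K →L[ℂ] K) → UAlg K, ContDiffOn ℝ ∞ f N ∧
      ∀ g' ∈ e.source, (g' : K →L[ℂ] K) ∈ N → f g' = e g'

end UnitaryGroup

/-! ### The charts of the groupoid of partial isometries -/

section Charts

variable {Hp : Submodule ℂ H} [CompleteSpace Hp]

/-- The operator `(σ_γ(u u*)⁻¹ u σ_β(u* u))|_{Hp}` on `Hp`. -/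
def transportOp (σγ σβ : GrRes Hp → URes Hp) (u : PartIsoRes Hp) : Hp →L[ℂ] Hp :=
  Hp.orthogonalProjectionOnto ∘L
    ((((σγ u.target).toUnitary⁻¹ : unitary (H →L[ℂ] H)) : H →L[ℂ] H) * u.1 *
      ((σβ u.source).toUnitary : H →L[ℂ] H)) ∘L Hp.subtypeL

open Classical in
/-- `transportOp` as an element of the unitary group of `Hp` (it is unitary whenever the sections
are cross-sections near the target and the source of `u`; otherwise the value is irrelevant). -/
def transport (σγ σβ : GrRes Hp → URes Hp) (u : PartIsoRes Hp) : UGroup Hp :=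
  if h : transportOp σγ σβ u ∈ unitary (Hp →L[ℂ] Hp) then ⟨transportOp σγ σβ u, h⟩ else 1

variable {I J : Type*} (ψ : I → OpenPartialHomeomorph (UGroup Hp) (UAlg Hp)) (W : J → GrRes Hp)
  (Ω : J → Set (GrRes Hp)) (σ : J → GrRes Hp → URes Hp)

/-- The model space `L²(W_γ, W_γᗮ) × L²(W_β, W_βᗮ) × 𝔲₊`. -/
abbrev resModel (β γ : J) : Type _ :=
  HS (W γ).space (W γ).spaceᗮ × HS (W β).space (W β).spaceᗮ × UAlg Hp

/-- The chart domain `Ω_{αβγ}`, for the index `i = (α, β, γ)`. -/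
def resDom (i : I × J × J) : Set (PartIsoRes Hp) :=
  {u | u.source ∈ Ω i.2.1 ∧ u.target ∈ Ω i.2.2 ∧
    transportOp (σ i.2.2) (σ i.2.1) u ∈ unitary (Hp →L[ℂ] Hp) ∧
    transport (σ i.2.2) (σ i.2.1) u ∈ (ψ i.1).source}

/-- The chart `Φ_{αβγ}`, for the index `i = (α, β, γ)`. -/
def resChart (i : I × J × J) (u : PartIsoRes Hp) : resModel W i.2.1 i.2.2 :=
  (grChart (W i.2.2) u.target, grChart (W i.2.1) u.source,
    ψ i.1 (transport (σ i.2.2) (σ i.2.1) u))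

end Charts

end

/-! Let `a = σγ(uu*)` and `b = σβ(u*u)`. Since `b P₊ b* = u*u` and `a P₊ a* = uu*`, the operator `a*
u b` lives on `Hp` and is unitary there. Conversely `u = a T b*` for the extension by zero `T` of
that unitary. Hence the partial isometries with source in `Ωβ` and target in `Ωγ` correspond
bijectively to triples (target, source, unitary of `Hp`): `PartIsoRes.eq_mul_dilate_mul` gives
injectivity and `exists_partIsoRes` surjectivity. In these coordinates the chart is a product of two
Grassmannian charts and a chart of the unitary group, so its image is a product of open sets
(`image_resChart_inter`).

A change of cross-sections only replaces `T` by the compression of `a'* a T b* b'`. This is smooth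
in the coordinates because the cross-sections are smooth in operator norm, multiplication is bounded
bilinear and the adjoint is bounded real linear (`exists_contDiffOn_transportOp`).

The Grassmannian itself must be shown to be a manifold. Points of the chart domain at `W` are graphs
of Hilbert–Schmidt operators `A : W → Wᗮ` (`GrRes.isHilbertSchmidt_proj_orthogonal`). Every such
graph occurs, since Hilbert–Schmidt perturbations preserve the Fredholm property
(`ContinuousLinearMap.IsFredholm.add_isHilbertSchmidt`). The coordinate change is the fractional
linear map `A ↦ P_{W'ᗮ}(1 + A) (P_{W'}(1 + A))⁻¹`, smooth on the open set where the denominator is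
invertible.

The Hausdorff property holds because the inclusion into the bounded operators is injective and, by
the formula `u = a T b*`, continuous (`smoothOnAtlas_coe`). -/

noncomputable section

set_option linter.unusedSectionVars false

/-! ### Estimates for Hilbert–Schmidt operators -/

section HilbertSchmidtTheory

variable {E F G : Type*} [NormedAddCommGroup E] [InnerProductSpace ℂ E] [CompleteSpace E]
  [NormedAddCommGroup F] [InnerProductSpace ℂ F] [NormedAddCommGroup G] [InnerProductSpace ℂ G]

/-- The square `∑ ‖A eᵢ‖²` of the Hilbert–Schmidt norm, as an extended real number. -/
def hsSum (A : E →L[ℂ] F) : ENNReal := ∑' i, ‖A (hsBasis E i)‖ₑ ^ 2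

theorem isHilbertSchmidt_iff_hsSum (A : E →L[ℂ] F) : IsHilbertSchmidt A ↔ hsSum A ≠ ⊤ :=
  summable_norm_sq_iff _

theorem hsSum_adjoint [CompleteSpace F] (A : E →L[ℂ] F) :
    hsSum (ContinuousLinearMap.adjoint A) = hsSum A :=
  (tsum_enorm_sq_eq_adjoint (hsBasis E) (hsBasis F) A).symm

theorem hsSum_comp_le (B : F →L[ℂ] G) (A : E →L[ℂ] F) :
    hsSum (B ∘L A) ≤ ‖B‖ₑ ^ 2 * hsSum A := by
  rw [hsSum, hsSum, ← ENNReal.tsum_mul_left]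
  refine ENNReal.tsum_le_tsum fun i => ?_
  rw [← mul_pow]
  exact pow_le_pow_left' (B.le_opENorm _) 2

/-- Right composition does not act termwise on a basis; passing to adjoints turns it into left
composition without changing the sum. -/
theorem hsSum_comp_le' [CompleteSpace F] [CompleteSpace G] (A : F →L[ℂ] G) (B : E →L[ℂ] F) :
    hsSum (A ∘L B) ≤ ‖B‖ₑ ^ 2 * hsSum A := by
  rw [← hsSum_adjoint, ContinuousLinearMap.adjoint_comp, ← hsSum_adjoint A]
  refine (hsSum_comp_le _ _).trans_eq ?_
  rw [← ofReal_norm, ← ofReal_norm, LinearIsometryEquiv.norm_map]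

theorem IsHilbertSchmidt.clm_comp {A : E →L[ℂ] F} (hA : IsHilbertSchmidt A) (B : F →L[ℂ] G) :
    IsHilbertSchmidt (B ∘L A) := by
  rw [isHilbertSchmidt_iff_hsSum] at *
  exact ne_top_of_le_ne_top (ENNReal.mul_ne_top (by simp) hA) (hsSum_comp_le B A)

theorem IsHilbertSchmidt.comp_clm [CompleteSpace F] [CompleteSpace G] {A : F →L[ℂ] G}
    (hA : IsHilbertSchmidt A) (B : E →L[ℂ] F) : IsHilbertSchmidt (A ∘L B) := by
  rw [isHilbertSchmidt_iff_hsSum] at *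
  exact ne_top_of_le_ne_top (ENNReal.mul_ne_top (by simp) hA) (hsSum_comp_le' A B)

theorem IsHilbertSchmidt.add {A B : E →L[ℂ] F} (hA : IsHilbertSchmidt A)
    (hB : IsHilbertSchmidt B) : IsHilbertSchmidt (A + B) :=
  (hsSubmodule E F).add_mem hA hB

theorem IsHilbertSchmidt.neg {A : E →L[ℂ] F} (hA : IsHilbertSchmidt A) : IsHilbertSchmidt (-A) :=
  (hsSubmodule E F).neg_mem hA

theorem isHilbertSchmidt_of_finiteDimensional [FiniteDimensional ℂ E] (A : E →L[ℂ] F) :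
    IsHilbertSchmidt A := by
  have : Finite (hsIndex E) :=
    ((hsBasis E).orthonormal.linearIndependent).finite
  exact Summable.of_finite

theorem isHilbertSchmidt_of_finite_range [CompleteSpace F] (A : E →L[ℂ] F)
    [FiniteDimensional ℂ A.range] : IsHilbertSchmidt A := by
  have : CompleteSpace A.range := FiniteDimensional.complete ℂ _
  have h := ((isHilbertSchmidt_of_finiteDimensional
    (ContinuousLinearMap.id ℂ A.range)).comp_clm A.rangeRestrict).clm_comp A.range.subtypeL
  exact h

/-- Parseval gives `‖A* y‖² = ∑ |⟪A eᵢ, y⟫|²`, and Cauchy–Schwarz bounds each term; then `‖A*‖ =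
‖A‖`. -/
theorem enorm_sq_le_hsSum [CompleteSpace F] (A : E →L[ℂ] F) : ‖A‖ₑ ^ 2 ≤ hsSum A := by
  have key : ∀ y, ‖ContinuousLinearMap.adjoint A y‖ₑ ^ 2 ≤ hsSum A * ‖y‖ₑ ^ 2 := fun y => by
    rw [← (hsBasis E).tsum_enorm_inner_sq, hsSum, ← ENNReal.tsum_mul_right]
    refine ENNReal.tsum_le_tsum fun i => ?_
    rw [ContinuousLinearMap.adjoint_inner_right, ← mul_pow]
    refine pow_le_pow_left' ?_ 2
    rw [← ofReal_norm, ← ofReal_norm, ← ofReal_norm, ← ENNReal.ofReal_mul (norm_nonneg _)]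
    exact ENNReal.ofReal_le_ofReal (norm_inner_le_norm _ _)
  by_cases hA : hsSum A = ⊤
  · simp [hA]
  obtain ⟨r, hr⟩ : ∃ r : NNReal, (r : ENNReal) = hsSum A := ⟨_, ENNReal.coe_toNNReal hA⟩
  have h : ‖ContinuousLinearMap.adjoint A‖ ≤ √r := by
    refine ContinuousLinearMap.opNorm_le_bound _ (Real.sqrt_nonneg _) fun y => ?_
    refine le_of_sq_le_sq ?_ (by positivity)
    have := key y
    rw [← hr, ← enorm_norm, ← enorm_norm y] at this
    rw [mul_pow, Real.sq_sqrt r.coe_nonneg]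
    have h3 := ENNReal.toReal_mono (by finiteness) this
    simpa using h3
  rw [LinearIsometryEquiv.norm_map] at h
  rw [← hr, ← ofReal_norm, ← ENNReal.ofReal_pow (norm_nonneg _)]
  refine ENNReal.ofReal_le_of_le_toReal ?_
  simpa using (pow_le_pow_left₀ (norm_nonneg _) h 2).trans_eq (Real.sq_sqrt r.coe_nonneg)

namespace HS

@[simp] theorem toCLM_mk (A : E →L[ℂ] F) (hA : IsHilbertSchmidt A) : (mk A hA).toCLM = A := rfl

@[ext] theorem ext {A B : HS E F} (h : A.toCLM = B.toCLM) : A = B := Subtype.ext h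

theorem isHilbertSchmidt (A : HS E F) : IsHilbertSchmidt A.toCLM := A.2

theorem enorm_sq_eq (A : HS E F) : ‖A‖ₑ ^ 2 = hsSum A.toCLM := by
  rw [← ofReal_norm, ← ENNReal.ofReal_pow (norm_nonneg _), norm_sq_eq,
    ENNReal.ofReal_tsum_of_nonneg (fun i => by positivity) A.isHilbertSchmidt, hsSum]
  simp [ENNReal.ofReal_pow, ofReal_norm]

theorem norm_le_of_hsSum_le {E' F' : Type*} [NormedAddCommGroup E'] [InnerProductSpace ℂ E']
    [CompleteSpace E'] [NormedAddCommGroup F'] [InnerProductSpace ℂ F'] {A : HS E F}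
    {B : HS E' F'} {c : ℝ} (hc : 0 ≤ c)
    (h : hsSum A.toCLM ≤ ENNReal.ofReal c ^ 2 * hsSum B.toCLM) : ‖A‖ ≤ c * ‖B‖ := by
  rw [← enorm_sq_eq, ← enorm_sq_eq, ← mul_pow, ← ofReal_norm, ← ofReal_norm,
    ← ENNReal.ofReal_mul hc, ← ENNReal.ofReal_pow (by positivity),
    ← ENNReal.ofReal_pow (by positivity), ENNReal.ofReal_le_ofReal_iff (by positivity)] at h
  exact le_of_sq_le_sq h (by positivity)

theorem norm_toCLM_le [CompleteSpace F] (A : HS E F) : ‖A.toCLM‖ ≤ ‖A‖ := by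
  have h := enorm_sq_le_hsSum A.toCLM
  rw [← enorm_sq_eq, ← ofReal_norm, ← ofReal_norm, ← ENNReal.ofReal_pow (by positivity),
    ← ENNReal.ofReal_pow (by positivity), ENNReal.ofReal_le_ofReal_iff (by positivity)] at h
  exact le_of_sq_le_sq h (by positivity)

variable (E F) in
/-- The inclusion of the Hilbert–Schmidt operators into the bounded operators. -/
def toCLML [CompleteSpace F] : HS E F →L[ℂ] E →L[ℂ] F :=
  LinearMap.mkContinuous ⟨⟨toCLM, fun _ _ => rfl⟩, fun _ _ => rfl⟩ 1
    fun A => A.norm_toCLM_le.trans_eq (one_mul _).symm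

/-- Composition with a bounded operator on the left, `A ↦ B A`. -/
def clmComp (B : F →L[ℂ] G) : HS E F →L[ℂ] HS E G :=
  LinearMap.mkContinuous
    ⟨⟨fun A => mk (B ∘L A.toCLM) (A.isHilbertSchmidt.clm_comp B),
      fun A A' => HS.ext (ContinuousLinearMap.comp_add B A.toCLM A'.toCLM)⟩,
      fun c A => HS.ext (ContinuousLinearMap.comp_smul B c A.toCLM)⟩ ‖B‖
    fun A => norm_le_of_hsSum_le (norm_nonneg B) (by
      rw [ofReal_norm]; exact hsSum_comp_le B A.toCLM)

variable (E F G) in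
/-- Composition `(A, B) ↦ A B` of a Hilbert–Schmidt operator and a bounded operator. -/
def compCLM [CompleteSpace F] [CompleteSpace G] : HS F G →L[ℂ] (E →L[ℂ] F) →L[ℂ] HS E G :=
  LinearMap.mkContinuous₂
    (LinearMap.mk₂ ℂ (fun A B => mk (A.toCLM ∘L B) (A.isHilbertSchmidt.comp_clm B))
      (fun A A' B => HS.ext (ContinuousLinearMap.add_comp A.toCLM A'.toCLM B))
      (fun c A B => HS.ext (ContinuousLinearMap.smul_comp c A.toCLM B))
      (fun A B B' => HS.ext (ContinuousLinearMap.comp_add A.toCLM B B'))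
      (fun c A B => HS.ext (ContinuousLinearMap.comp_smul A.toCLM c B))) 1
    fun A B => by
      rw [one_mul, mul_comm]
      exact norm_le_of_hsSum_le (norm_nonneg B) (by
        rw [ofReal_norm]; exact hsSum_comp_le' A.toCLM B)

@[simp] theorem toCLM_compCLM [CompleteSpace F] [CompleteSpace G] (A : HS F G) (B : E →L[ℂ] F) :
    (compCLM E F G A B).toCLM = A.toCLM ∘L B := rfl

theorem isometry_toLp : Isometry (toLp E F) :=
  AddMonoidHomClass.isometry_of_norm (toLp E F) fun _ => rfl

theorem isClosed_range_toLp [CompleteSpace F] : IsClosed (range (toLp E F)) := by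
  refine IsSeqClosed.isClosed fun f y hf hy => ?_
  choose A hA using hf
  have hc : CauchySeq A := by
    have := hy.cauchySeq
    rw [← funext hA] at this
    exact (isometry_toLp.isUniformInducing.cauchy_map_iff).1 (by rwa [Filter.map_map])
  -- The operator norm is dominated by the Hilbert–Schmidt norm, so the operators also converge in
  -- norm. Evaluating at basis vectors identifies the limit with the `ℓ²` limit `y`.
  obtain ⟨B, hB⟩ := cauchySeq_tendsto_of_complete
    ((toCLML E F).uniformContinuous.comp_cauchySeq hc)
  have hi : ∀ i, B (hsBasis E i) = y i := fun i => by
    have h1 : Filter.Tendsto (fun n => (f n) i) Filter.atTop (𝓝 (y i)) :=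
      ((lp.evalCLM ℂ (fun _ : hsIndex E => F) 2 i).continuous.tendsto y).comp hy
    have h2 := ((ContinuousLinearMap.apply ℂ F (hsBasis E i)).continuous.tendsto B).comp hB
    refine tendsto_nhds_unique h2 (h1.congr fun n => ?_)
    rw [← hA]; rfl
  have hBHS : IsHilbertSchmidt B := by
    rw [isHilbertSchmidt_iff_memℓp, funext hi]
    exact y.2
  exact ⟨mk B hBHS, Subtype.ext (funext hi)⟩

instance [CompleteSpace F] : CompleteSpace (HS E F) :=
  (completeSpace_iff_isComplete_range isometry_toLp.isUniformInducing).2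
    isClosed_range_toLp.isComplete

end HS

/-! ### Hilbert–Schmidt perturbations of Fredholm operators -/

/-- Restricting `A` to the span of finitely many basis vectors leaves a remainder whose squared
Hilbert–Schmidt norm is a tail of a convergent series. -/
theorem IsHilbertSchmidt.exists_finite_range_norm_sub_lt [CompleteSpace F] {A : E →L[ℂ] F}
    (hA : IsHilbertSchmidt A) {ε : ℝ} (hε : 0 < ε) :
    ∃ B : E →L[ℂ] F, FiniteDimensional ℂ B.range ∧ ‖A - B‖ < ε := by
  classical
  obtain ⟨s, hs⟩ := ((tendsto_order.1 (tendsto_tsum_compl_atTop_zero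
    (fun i => ‖A (hsBasis E i)‖ ^ 2))).2 (ε ^ 2) (by positivity)).exists
  let U : Submodule ℂ E := Submodule.span ℂ (hsBasis E '' s)
  have hU : FiniteDimensional ℂ U := FiniteDimensional.span_of_finite ℂ (s.finite_toSet.image _)
  have hin : ∀ i ∈ s, U.starProjection (hsBasis E i) = hsBasis E i := fun i hi =>
    Submodule.starProjection_eq_self_iff.2 (Submodule.subset_span ⟨i, hi, rfl⟩)
  have hout : ∀ i, i ∉ s → U.starProjection (hsBasis E i) = 0 := fun i hi => by
    rw [Submodule.starProjection_apply_eq_zero_iff]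
    refine (Submodule.mem_orthogonal _ _).2 fun x hx => ?_
    induction hx using Submodule.span_induction with
    | mem x hx =>
      obtain ⟨j, hj, rfl⟩ := hx
      exact (hsBasis E).orthonormal.2 fun h => hi (h ▸ hj)
    | zero => simp
    | add x y _ _ hx hy => rw [inner_add_left, hx, hy, add_zero]
    | smul c x _ hx => rw [inner_smul_left, hx, mul_zero]
  refine ⟨A ∘L U.starProjection, ?_, ?_⟩
  · have : FiniteDimensional ℂ (U.map (A : E →ₗ[ℂ] F)) := inferInstance
    refine Submodule.finiteDimensional_of_le (S₂ := U.map (A : E →ₗ[ℂ] F)) ?_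
    rintro _ ⟨x, rfl⟩
    exact ⟨_, Submodule.starProjection_apply_mem U x, rfl⟩
  · have h1 := enorm_sq_le_hsSum (A - A ∘L U.starProjection)
    have h2 : hsSum (A - A ∘L U.starProjection) =
        ENNReal.ofReal (∑' i : { i // i ∉ s}, ‖A (hsBasis E i)‖ ^ 2) := by
      have hs' : Summable fun i : {i // i ∉ s} => ‖A (hsBasis E i)‖ ^ 2 := hA.subtype _
      rw [ENNReal.ofReal_tsum_of_nonneg (fun i => by positivity) hs', hsSum,
        ← tsum_subtype_eq_of_support_subset (s := {i | i ∉ s})]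
      · refine tsum_congr fun i => ?_
        simp [hout i.1 i.2, ENNReal.ofReal_pow, ofReal_norm]
      · intro i hi hi'
        simp [hin i hi'] at hi
    rw [h2, ← ofReal_norm, ← ENNReal.ofReal_pow (norm_nonneg _),
      ENNReal.ofReal_le_ofReal_iff (tsum_nonneg fun _ => by positivity)] at h1
    exact lt_of_pow_lt_pow_left₀ 2 hε.le (h1.trans_lt hs)

end HilbertSchmidtTheory

/-! ### Fredholm operators under finite-rank and small perturbations -/

section Fredholm

open LinearMap.FiniteRangeSetoid

variable {E F G : Type*} [NormedAddCommGroup E] [NormedSpace ℂ E]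
  [NormedAddCommGroup F] [NormedSpace ℂ F] [NormedAddCommGroup G] [NormedSpace ℂ G]

/-- Quasi-inverses are defined modulo operators of finite rank, so a quasi-inverse of `T` also
serves `T + K`. -/
theorem ContinuousLinearMap.IsFredholm.add_finite_range {T K : E →L[ℂ] F} (hT : T.IsFredholm)
    [hK : FiniteDimensional ℂ K.range] : (T + K).IsFredholm := by
  obtain ⟨S, hS⟩ := hT.exists_isQuasiInverse
  refine .of_isQuasiInverse (v := S) ?_
  have h : ((T + K : E →L[ℂ] F) : E →ₗ[ℂ] F) ≈ (T : E →ₗ[ℂ] F) := by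
    rw [equiv_iff_hasNoetherianRange]
    simp only [ContinuousLinearMap.toLinearMap_add, add_sub_cancel_left]
    change IsNoetherian ℂ K.range
    infer_instance
  exact ⟨hS.1.congr (Setoid.refl _) h, hS.2.congr (Setoid.refl _) h⟩

theorem ContinuousLinearMap.IsFredholm.comp_equiv {T : F →L[ℂ] G}
    (hT : T.IsFredholm) (e : E ≃L[ℂ] F) : (T ∘L (e : E →L[ℂ] F)).IsFredholm := by
  obtain ⟨S, hS⟩ := hT.exists_isQuasiInverse
  exact .of_isQuasiInverse (v := (e.symm : F →L[ℂ] E) ∘L S)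
    (e.toLinearEquiv.isQuasiInverse.comp hS)

/-- Modulo finite rank, `S'(T + S)` is `D = 1 + S'S` and `(T + S)S'` is `D' = 1 + SS'`, both
invertible by the Neumann series. Since `D S' = S' D'`, the operator `D⁻¹S' = S'D'⁻¹` is a
quasi-inverse of `T + S` on both sides. -/
theorem ContinuousLinearMap.IsFredholm.add_of_norm_lt [CompleteSpace E] [CompleteSpace F] {T S : E →L[ℂ] F} {S' : F →L[ℂ] E}
    (hS' : S'.IsQuasiInverse T) (h : ‖S'‖ * ‖S‖ < 1) : (T + S).IsFredholm := by
  have h1 : ‖-(S' ∘L S)‖ < 1 := by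
    rw [norm_neg]; exact (opNorm_comp_le _ _).trans_lt h
  have h2 : ‖-(S ∘L S')‖ < 1 := by
    rw [norm_neg]; exact (opNorm_comp_le _ _).trans_lt (by rwa [mul_comm])
  let D : (E →L[ℂ] E)ˣ := Units.oneSub _ h1
  let D' : (F →L[ℂ] F)ˣ := Units.oneSub _ h2
  have hD : (D : E →L[ℂ] E) = 1 + S' ∘L S := sub_neg_eq_add _ _
  have hD' : (D' : F →L[ℂ] F) = 1 + S ∘L S' := sub_neg_eq_add _ _
  have hcomm : (D : E →L[ℂ] E) ∘L S' = S' ∘L (D' : F →L[ℂ] F) := by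
    rw [hD, hD']; ext x; simp
  have hDi : ((D⁻¹ : (E →L[ℂ] E)ˣ) : E →L[ℂ] E) ∘L (D : E →L[ℂ] E) = .id ℂ E := D.inv_mul
  have hDi' : (D' : F →L[ℂ] F) ∘L ((D'⁻¹ : (F →L[ℂ] F)ˣ) : F →L[ℂ] F) = .id ℂ F := D'.mul_inv
  have hcomm' : ((D⁻¹ : (E →L[ℂ] E)ˣ) : E →L[ℂ] E) ∘L S' =
      S' ∘L ((D'⁻¹ : (F →L[ℂ] F)ˣ) : F →L[ℂ] F) := by
    calc _ = (D⁻¹ : (E →L[ℂ] E)ˣ).1 ∘L S' ∘L (D'.1 ∘L (D'⁻¹).1) := by rw [hDi']; rfl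
      _ = (D⁻¹ : (E →L[ℂ] E)ˣ).1 ∘L (D.1 ∘L S') ∘L (D'⁻¹).1 := by rw [hcomm]; rfl
      _ = ((D⁻¹ : (E →L[ℂ] E)ˣ).1 ∘L D.1) ∘L S' ∘L (D'⁻¹).1 := rfl
      _ = _ := by rw [hDi]; rfl
  refine .of_isQuasiInverse (v := (D⁻¹ : (E →L[ℂ] E)ˣ).1 ∘L S') ⟨?_, ?_⟩
  · have e1 : ((S' ∘L (T + S) : E →L[ℂ] E) : E →ₗ[ℂ] E) ≈ (D.1 : E →ₗ[ℂ] E) := by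
      have := hS'.1
      rw [LinearMap.IsLeftQuasiInverse, equiv_iff_hasNoetherianRange] at this
      rw [equiv_iff_hasNoetherianRange]
      convert! this using 1
      rw [hD]; ext x; simp
    have := equiv_comp_left (u' := ((D⁻¹ : (E →L[ℂ] E)ˣ).1 : E →ₗ[ℂ] E)) e1
    refine Setoid.trans this ?_
    have h3 := congrArg ContinuousLinearMap.toLinearMap hDi
    rw [ContinuousLinearMap.toLinearMap_comp] at h3
    rw [h3]
    exact Setoid.refl _
  · rw [hcomm']
    have e1 : (((T + S) ∘L S' : F →L[ℂ] F) : F →ₗ[ℂ] F) ≈ (D'.1 : F →ₗ[ℂ] F) := by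
      have := hS'.2
      rw [LinearMap.IsRightQuasiInverse, equiv_iff_hasNoetherianRange] at this
      rw [equiv_iff_hasNoetherianRange]
      convert! this using 1
      rw [hD']; ext x; simp
    have := equiv_comp_right (u := ((D'⁻¹ : (F →L[ℂ] F)ˣ).1 : F →ₗ[ℂ] F)) e1
    refine Setoid.trans this ?_
    have h3 := congrArg ContinuousLinearMap.toLinearMap hDi'
    rw [ContinuousLinearMap.toLinearMap_comp] at h3
    rw [h3]
    exact Setoid.refl _

end Fredholm

theorem ContinuousLinearMap.IsFredholm.add_isHilbertSchmidt {E F : Type*}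
    [NormedAddCommGroup E] [InnerProductSpace ℂ E] [CompleteSpace E]
    [NormedAddCommGroup F] [InnerProductSpace ℂ F] [CompleteSpace F] {T K : E →L[ℂ] F}
    (hT : T.IsFredholm) (hK : IsHilbertSchmidt K) : (T + K).IsFredholm := by
  obtain ⟨S, hS⟩ := hT.exists_isQuasiInverse
  -- The `+ 1` gives `‖S‖ * ε < 1` also when `S = 0`.
  obtain ⟨B, hB, hlt⟩ := hK.exists_finite_range_norm_sub_lt (ε := (‖S‖ + 1)⁻¹) (by positivity)
  have h1 : ‖S‖ * ‖K - B‖ < 1 := by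
    calc ‖S‖ * ‖K - B‖ ≤ ‖S‖ * (‖S‖ + 1)⁻¹ := by gcongr
      _ < 1 := by rw [← div_eq_mul_inv, div_lt_one (by positivity)]; linarith
  have h2 := (IsFredholm.add_of_norm_lt hS h1).add_finite_range (K := B)
  rwa [add_assoc, sub_add_cancel] at h2

/-! ### Topology of a manifold given by an atlas -/

section AtlasTopology

variable {M ι : Type*} {E : ι → Type*} [∀ i, NormedAddCommGroup (E i)] [∀ i, NormedSpace ℝ (E i)]
  {dom : ι → Set M} {φ : ∀ i, M → E i}

/-- Induction on the generation of the topology: generating sets are handled by continuity of the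
transition maps, and finite intersections by injectivity of the chart. -/
theorem IsSmoothAtlas.isOpen_image_inter (h : IsSmoothAtlas dom φ) {s : Set M}
    (hs : IsOpen[atlasTopology dom φ] s) (i : ι) : IsOpen (φ i '' (dom i ∩ s)) := by
  change TopologicalSpace.GenerateOpen _ s at hs
  induction hs with
  | basic s hs =>
    obtain ⟨j, O, hO, rfl⟩ := hs
    obtain ⟨g, hg, hgφ⟩ := h.smooth_transition i j
    convert! hg.continuousOn.isOpen_inter_preimage (h.isOpen_image i j) hO using 1
    ext y
    constructor
    · rintro ⟨x, ⟨hi, hj, hx⟩, rfl⟩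
      exact ⟨⟨x, ⟨hi, hj⟩, rfl⟩, by simpa [hgφ x ⟨hi, hj⟩] using hx⟩
    · rintro ⟨⟨x, hij, rfl⟩, hx⟩
      rw [mem_preimage, hgφ x hij] at hx
      exact ⟨x, ⟨hij.1, hij.2, hx⟩, rfl⟩
  | univ =>
    rw [inter_univ, ← inter_self (dom i)]
    exact h.isOpen_image i i
  | inter s t _ _ hs ht =>
    rw [inter_inter_distrib_left,
      ((h.injOn i).image_inter inter_subset_left inter_subset_left)]
    exact hs.inter ht
  | sUnion S _ hS =>
    rw [sUnion_eq_biUnion, inter_iUnion₂, image_iUnion₂]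
    exact isOpen_biUnion hS

theorem SmoothOnAtlas.continuous {F : Type*} [NormedAddCommGroup F] [NormedSpace ℝ F] {f : M → F}
    (hf : SmoothOnAtlas dom φ f univ) (h : IsSmoothAtlas dom φ) :
    Continuous[atlasTopology dom φ, inferInstance] f := by
  let _ := atlasTopology dom φ
  refine continuous_def.2 fun O hO => ?_
  have : f ⁻¹' O = ⋃ i, dom i ∩ f ⁻¹' O := by rw [← iUnion_inter, h.cover, univ_inter]
  rw [this]
  refine isOpen_iUnion fun i => ?_
  obtain ⟨g, hg, hgf⟩ := hf i
  simp only [univ_inter] at hg hgf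
  have hopen : IsOpen (φ i '' dom i) := by simpa using h.isOpen_image i i
  refine .basic _ ⟨i, _, hg.continuousOn.isOpen_inter_preimage hopen hO, ?_⟩
  ext x
  constructor
  · rintro ⟨hi, hx⟩
    exact ⟨hi, ⟨x, hi, rfl⟩, by simpa [hgf x hi] using hx⟩
  · rintro ⟨hi, -, hx⟩
    exact ⟨hi, by simpa [hgf x hi] using hx⟩

end AtlasTopology

/-! ### Graphs of operators and projections between subspaces -/

section Graph

variable {H : Type*} [NormedAddCommGroup H] [InnerProductSpace ℂ H] [CompleteSpace H]
  (W V : Submodule ℂ H) [CompleteSpace W] [CompleteSpace V]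

theorem subtypeL_comp_proj_add :
    W.subtypeL ∘L W.orthogonalProjectionOnto + Wᗮ.subtypeL ∘L Wᗮ.orthogonalProjectionOnto =
      .id ℂ H := by
  ext x
  exact W.starProjection_add_starProjection_orthogonal x

theorem proj_comp_subtypeL : W.orthogonalProjectionOnto ∘L W.subtypeL = .id ℂ W := by
  ext x; simp

theorem proj_comp_subtypeL_orthogonal : W.orthogonalProjectionOnto ∘L Wᗮ.subtypeL = 0 := by
  refine ContinuousLinearMap.ext fun x => ?_
  rw [ContinuousLinearMap.comp_apply, Submodule.subtypeL_apply,
    Submodule.orthogonalProjectionOnto_eq_zero_iff.2 x.2, zero_apply]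

theorem proj_orthogonal_comp_subtypeL : Wᗮ.orthogonalProjectionOnto ∘L W.subtypeL = 0 :=
  Submodule.orthogonalProjectionOnto_comp_subtypeL_eq_zero_iff.mpr fun _ a => a

/-- The kernel of the projection `V → W` is `V ⊓ Wᗮ`, and it is onto exactly when `V ⊔ Wᗮ` is
everything; the open mapping theorem makes the inverse bounded. -/
theorem isInvertible_proj_comp_subtypeL_iff :
    (W.orthogonalProjectionOnto ∘L V.subtypeL).IsInvertible ↔ IsCompl V Wᗮ := by
  constructor
  · intro h
    refine IsCompl.of_le (fun x hx => ?_) fun x _ => ?_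
    · have h0 : (W.orthogonalProjectionOnto ∘L V.subtypeL) ⟨x, hx.1⟩ = 0 := by
        rw [ContinuousLinearMap.comp_apply, Submodule.subtypeL_apply,
          Submodule.orthogonalProjectionOnto_eq_zero_iff.2 hx.2]
      have h1 : (⟨x, hx.1⟩ : V) = 0 := h.injective (by rw [h0, map_zero])
      exact (Submodule.mk_eq_zero V hx.1).1 h1
    · obtain ⟨v, hv⟩ := h.surjective (W.orthogonalProjectionOnto x)
      refine Submodule.mem_sup.2 ⟨v, v.2, x - v, ?_, by abel⟩
      rw [← Submodule.orthogonalProjectionOnto_eq_zero_iff, map_sub, sub_eq_zero]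
      exact hv.symm
  · intro h
    refine ⟨ContinuousLinearEquiv.ofBijective (W.orthogonalProjectionOnto ∘L V.subtypeL) ?_ ?_,
      ContinuousLinearEquiv.coe_ofBijective _ _ _⟩
    · refine (Submodule.eq_bot_iff _).2 fun v hv => ?_
      have hv' : W.orthogonalProjectionOnto (v : H) = 0 := hv
      have : (v : H) ∈ V ⊓ Wᗮ := ⟨v.2, Submodule.orthogonalProjectionOnto_eq_zero_iff.1 hv'⟩
      rw [h.inf_eq_bot] at this
      exact Subtype.ext this
    · refine (Submodule.eq_top_iff').2 fun w => ?_
      have : (w : H) ∈ V ⊔ Wᗮ := h.sup_eq_top ▸ Submodule.mem_top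
      obtain ⟨v, hv, y, hy, hvy⟩ := Submodule.mem_sup.1 this
      refine ⟨⟨v, hv⟩, ?_⟩
      have h1 := congrArg W.orthogonalProjectionOnto hvy
      rw [map_add, Submodule.orthogonalProjectionOnto_eq_zero_iff.2 hy, add_zero] at h1
      simpa using h1

variable {W} in
/-- The map `x ↦ x + A x`, whose range is the graph of `A`. -/
def graphMap (A : W →L[ℂ] Wᗮ) : W →L[ℂ] H := W.subtypeL + Wᗮ.subtypeL ∘L A

variable {W} in
theorem proj_comp_graphMap (A : W →L[ℂ] Wᗮ) :
    W.orthogonalProjectionOnto ∘L graphMap A = .id ℂ W := by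
  rw [graphMap, ContinuousLinearMap.comp_add, ← ContinuousLinearMap.comp_assoc,
    proj_comp_subtypeL, proj_comp_subtypeL_orthogonal, ContinuousLinearMap.zero_comp, add_zero]

variable {W} in
theorem proj_orthogonal_comp_graphMap (A : W →L[ℂ] Wᗮ) :
    Wᗮ.orthogonalProjectionOnto ∘L graphMap A = A := by
  rw [graphMap, ContinuousLinearMap.comp_add, ← ContinuousLinearMap.comp_assoc,
    proj_comp_subtypeL, proj_orthogonal_comp_subtypeL, ContinuousLinearMap.id_comp, zero_add]

variable {W} in
/-- The graph of `A : W → Wᗮ`. -/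
def graphSpace (A : W →L[ℂ] Wᗮ) : Submodule ℂ H :=
  (Wᗮ.orthogonalProjectionOnto - A ∘L W.orthogonalProjectionOnto).ker

variable {W} in
theorem mem_graphSpace {A : W →L[ℂ] Wᗮ} {x : H} : x ∈ graphSpace A ↔
    Wᗮ.orthogonalProjectionOnto x = A (W.orthogonalProjectionOnto x) := by
  simp [graphSpace, sub_eq_zero]

instance (A : W →L[ℂ] Wᗮ) : CompleteSpace (graphSpace A) :=
  (ContinuousLinearMap.isClosed_ker
    (Wᗮ.orthogonalProjectionOnto - A ∘L W.orthogonalProjectionOnto)).completeSpace_coe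

variable {W} in
theorem graphMap_mem (A : W →L[ℂ] Wᗮ) (x : W) : graphMap A x ∈ graphSpace A := by
  rw [mem_graphSpace]
  have h1 := DFunLike.congr_fun (proj_comp_graphMap A) x
  have h2 := DFunLike.congr_fun (proj_orthogonal_comp_graphMap A) x
  simp only [ContinuousLinearMap.comp_apply, ContinuousLinearMap.id_apply] at h1 h2
  rw [h1, h2]

variable {W} in
/-- The isomorphism of the graph of `A : W → Wᗮ` with `W`, given by the projection. -/
def graphEquiv (A : W →L[ℂ] Wᗮ) : graphSpace A ≃L[ℂ] W :=
  ContinuousLinearEquiv.equivOfInverse' (W.orthogonalProjectionOnto ∘L (graphSpace A).subtypeL)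
    ((graphMap A).codRestrict _ (graphMap_mem A))
    (by
      rw [ContinuousLinearMap.comp_assoc]
      exact proj_comp_graphMap A)
    (by
      ext x
      have hx := mem_graphSpace.1 x.2
      simp [graphMap, ← hx])

variable {W} in
-- Transfers questions about the inclusion of the graph to `graphMap A`, which is defined on the
-- fixed space `W`.
theorem subtypeL_graphSpace (A : W →L[ℂ] Wᗮ) :
    (graphSpace A).subtypeL = graphMap A ∘L (graphEquiv A : graphSpace A →L[ℂ] W) := by
  ext x
  exact (congrArg Subtype.val ((graphEquiv A).symm_apply_apply x)).symm

end Graph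

/-! ### The restricted Grassmannian as a manifold -/

section Grassmannian

variable {H : Type*} [NormedAddCommGroup H] [InnerProductSpace ℂ H] [CompleteSpace H]
  {Hp : Submodule ℂ H} [CompleteSpace Hp]

theorem GrRes.ext_space {V W : GrRes Hp} (h : V.space = W.space) : V = W := by
  cases V; cases W; cases h; rfl

theorem GrRes.ext_starProjection {V W : GrRes Hp}
    (h : V.space.starProjection = W.space.starProjection) : V = W :=
  GrRes.ext_space (Submodule.starProjection_inj.1 h)

theorem ContinuousLinearMap.IsFredholm.exists_isHilbertSchmidt_comp_sub_id {E F : Type*}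
    [NormedAddCommGroup E] [InnerProductSpace ℂ E] [NormedAddCommGroup F]
    [InnerProductSpace ℂ F] [CompleteSpace F] {T : E →L[ℂ] F} (hT : T.IsFredholm) :
    ∃ (S : F →L[ℂ] E) (K : F →L[ℂ] F), IsHilbertSchmidt K ∧ T ∘L S + K = .id ℂ F := by
  obtain ⟨S, -, hS⟩ := hT.exists_isQuasiInverse
  rw [LinearMap.IsRightQuasiInverse,
    LinearMap.FiniteRangeSetoid.equiv_iff_hasNoetherianRange] at hS
  have hK : FiniteDimensional ℂ (T ∘L S - .id ℂ F).range := by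
    have : IsNoetherian ℂ (T ∘L S - .id ℂ F).range := hS
    infer_instance
  exact ⟨S, _, (isHilbertSchmidt_of_finite_range (T ∘L S - .id ℂ F)).neg, by abel⟩

/-- The definition of `GrRes` controls `P₋` on `W`, while here `P_{Wᗮ}` on `Hp` is needed. As
`P_{Wᗮ}` kills `W`, on `W` one has `P_{Wᗮ} P₊ = -P_{Wᗮ} P₋`, which is Hilbert–Schmidt. The Fredholm
property writes the identity of `Hp` as `P₊|_W S + K` with `K` Hilbert–Schmidt, which reaches all of
`Hp`. -/
theorem GrRes.isHilbertSchmidt_proj_orthogonal_polarization (W : GrRes Hp) :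
    IsHilbertSchmidt (W.spaceᗮ.orthogonalProjectionOnto ∘L Hp.subtypeL) := by
  obtain ⟨S, K, hK, hSK⟩ := W.fredholm.exists_isHilbertSchmidt_comp_sub_id
  have h1 : Hp.subtypeL ∘L (Hp.orthogonalProjectionOnto ∘L W.space.subtypeL) =
      W.space.subtypeL -
        Hpᗮ.subtypeL ∘L (Hpᗮ.orthogonalProjectionOnto ∘L W.space.subtypeL) := by
    rw [eq_sub_iff_add_eq, ← ContinuousLinearMap.comp_assoc,
      ← ContinuousLinearMap.comp_assoc, ← ContinuousLinearMap.add_comp, subtypeL_comp_proj_add,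
      ContinuousLinearMap.id_comp]
  have h2 : W.spaceᗮ.orthogonalProjectionOnto ∘L Hp.subtypeL =
      -((W.spaceᗮ.orthogonalProjectionOnto ∘L Hpᗮ.subtypeL) ∘L
        ((Hpᗮ.orthogonalProjectionOnto ∘L W.space.subtypeL) ∘L S)) +
      (W.spaceᗮ.orthogonalProjectionOnto ∘L Hp.subtypeL) ∘L K := by
    have h3 : (W.spaceᗮ.orthogonalProjectionOnto ∘L (Hp.subtypeL ∘L
        (Hp.orthogonalProjectionOnto ∘L W.space.subtypeL))) ∘L S =
        -((W.spaceᗮ.orthogonalProjectionOnto ∘L Hpᗮ.subtypeL) ∘L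
        ((Hpᗮ.orthogonalProjectionOnto ∘L W.space.subtypeL) ∘L S)) := by
      rw [h1, ContinuousLinearMap.comp_sub, proj_orthogonal_comp_subtypeL, zero_sub]
      simp only [ContinuousLinearMap.neg_comp, ContinuousLinearMap.comp_assoc]
    rw [← h3]
    conv_lhs => rw [← ContinuousLinearMap.comp_id (W.spaceᗮ.orthogonalProjectionOnto ∘L
      Hp.subtypeL), ← hSK, ContinuousLinearMap.comp_add]
    simp only [ContinuousLinearMap.comp_assoc]
  rw [h2]
  exact ((W.hilbertSchmidt.comp_clm S).clm_comp _).neg.add (hK.clm_comp _)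

/-- Insert `1 = P₊ + P₋` between the two maps: the `P₊` term is controlled by `W`, the `P₋` term by
`V`. -/
theorem GrRes.isHilbertSchmidt_proj_orthogonal (V W : GrRes Hp) :
    IsHilbertSchmidt (W.spaceᗮ.orthogonalProjectionOnto ∘L V.space.subtypeL) := by
  have h : W.spaceᗮ.orthogonalProjectionOnto ∘L V.space.subtypeL =
      (W.spaceᗮ.orthogonalProjectionOnto ∘L Hp.subtypeL) ∘L
        (Hp.orthogonalProjectionOnto ∘L V.space.subtypeL) +
      (W.spaceᗮ.orthogonalProjectionOnto ∘L Hpᗮ.subtypeL) ∘L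
        (Hpᗮ.orthogonalProjectionOnto ∘L V.space.subtypeL) := by
    conv_lhs => rw [← ContinuousLinearMap.id_comp V.space.subtypeL, ← subtypeL_comp_proj_add Hp,
      ContinuousLinearMap.add_comp, ContinuousLinearMap.comp_add]
    rfl
  rw [h]
  exact (W.isHilbertSchmidt_proj_orthogonal_polarization.comp_clm _).add
    (V.hilbertSchmidt.clm_comp _)

theorem isHilbertSchmidt_grChartOp (W V : GrRes Hp) : IsHilbertSchmidt (grChartOp W V) :=
  (V.isHilbertSchmidt_proj_orthogonal W).comp_clm _

theorem toCLM_grChart (W V : GrRes Hp) : (grChart W V).toCLM = grChartOp W V := by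
  rw [grChart, dif_pos (isHilbertSchmidt_grChartOp W V), HS.toCLM_mk]

theorem mem_grDom_iff {V W : GrRes Hp} : V ∈ grDom W ↔
    (W.space.orthogonalProjectionOnto ∘L V.space.subtypeL).IsInvertible :=
  (isInvertible_proj_comp_subtypeL_iff _ _).symm

theorem mem_grDom_self (W : GrRes Hp) : W ∈ grDom W :=
  Submodule.isCompl_orthogonal _

theorem graphMap_grChartOp {V W : GrRes Hp} (h : V ∈ grDom W) :
    graphMap (grChartOp W V) ∘L (W.space.orthogonalProjectionOnto ∘L V.space.subtypeL) =
      V.space.subtypeL := by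
  have h' := (mem_grDom_iff.1 h).inverse_comp_self
  rw [graphMap, ContinuousLinearMap.add_comp, ContinuousLinearMap.comp_assoc, grChartOp,
    ContinuousLinearMap.comp_assoc _ _ (W.space.orthogonalProjectionOnto ∘L V.space.subtypeL),
    h', ContinuousLinearMap.comp_id, ← ContinuousLinearMap.comp_assoc,
    ← ContinuousLinearMap.comp_assoc, ← ContinuousLinearMap.add_comp, subtypeL_comp_proj_add,
    ContinuousLinearMap.id_comp]

/-- The graph of a Hilbert–Schmidt operator `W → Wᗮ`, as a point of the restricted
Grassmannian. -/
def GrRes.graph (W : GrRes Hp) (A : HS W.space W.spaceᗮ) : GrRes Hp where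
  space := graphSpace A.toCLM
  complete := inferInstance
  fredholm := by
    rw [subtypeL_graphSpace, ← ContinuousLinearMap.comp_assoc]
    refine ContinuousLinearMap.IsFredholm.comp_equiv ?_ _
    rw [graphMap, ContinuousLinearMap.comp_add, ← ContinuousLinearMap.comp_assoc]
    -- Up to the isomorphism of the graph with `W`, the projection is `P₊|_W + P₊ A`.
    exact W.fredholm.add_isHilbertSchmidt (A.isHilbertSchmidt.clm_comp _)
  hilbertSchmidt := by
    rw [subtypeL_graphSpace, ← ContinuousLinearMap.comp_assoc]
    refine IsHilbertSchmidt.comp_clm ?_ _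
    rw [graphMap, ContinuousLinearMap.comp_add, ← ContinuousLinearMap.comp_assoc]
    exact W.hilbertSchmidt.add (A.isHilbertSchmidt.clm_comp _)

theorem GrRes.graph_mem_grDom (W : GrRes Hp) (A : HS W.space W.spaceᗮ) : W.graph A ∈ grDom W :=
  mem_grDom_iff.2 ⟨graphEquiv A.toCLM, rfl⟩

theorem grChart_graph (W : GrRes Hp) (A : HS W.space W.spaceᗮ) : grChart W (W.graph A) = A := by
  ext1
  rw [toCLM_grChart]
  change ((W.spaceᗮ.orthogonalProjectionOnto ∘L (graphSpace A.toCLM).subtypeL) ∘L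
    (graphEquiv A.toCLM : graphSpace A.toCLM →L[ℂ] W.space).inverse) = _
  rw [ContinuousLinearMap.inverse_equiv, subtypeL_graphSpace, ← ContinuousLinearMap.comp_assoc,
    proj_orthogonal_comp_graphMap, ContinuousLinearMap.comp_assoc,
    ContinuousLinearEquiv.coe_comp_coe_symm, ContinuousLinearMap.comp_id]

theorem space_eq_range_graphMap {V W : GrRes Hp} (h : V ∈ grDom W) :
    V.space = (graphMap (grChartOp W V)).range := by
  have h1 := graphMap_grChartOp h
  have h2 := (mem_grDom_iff.1 h).surjective
  ext x
  constructor
  · intro hx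
    exact ⟨_, DFunLike.congr_fun h1 ⟨x, hx⟩⟩
  · rintro ⟨w, rfl⟩
    obtain ⟨v, rfl⟩ := h2 w
    have := DFunLike.congr_fun h1 v
    exact this ▸ v.2

theorem injOn_grChart (W : GrRes Hp) : InjOn (grChart W) (grDom W) := by
  intro V hV U hU h
  have hop := congrArg HS.toCLM h
  rw [toCLM_grChart, toCLM_grChart] at hop
  apply GrRes.ext_space
  rw [space_eq_range_graphMap hV, space_eq_range_graphMap hU, hop]

/-- The operator `P_{W'} (1 + A) : W → W'`, which is invertible if and only if the graph of `A`
belongs to the domain of the chart at `W'`. -/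
def grDenominator (W W' : GrRes Hp) (A : HS W.space W.spaceᗮ) : W.space →L[ℂ] W'.space :=
  W'.space.orthogonalProjectionOnto ∘L W.space.subtypeL +
    (W'.space.orthogonalProjectionOnto ∘L W.spaceᗮ.subtypeL) ∘L A.toCLM

/-- The operator `P_{W'ᗮ} (1 + A) : W → W'ᗮ`. -/
def grNumerator (W W' : GrRes Hp) (A : HS W.space W.spaceᗮ) : HS W.space W'.spaceᗮ :=
  HS.mk _ (W.isHilbertSchmidt_proj_orthogonal W') +
    HS.clmComp (W'.spaceᗮ.orthogonalProjectionOnto ∘L W.spaceᗮ.subtypeL) A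

/-- The coordinate change from the chart at `W` to the chart at `W'`. -/
def grTransition (W W' : GrRes Hp) (A : HS W.space W.spaceᗮ) : HS W'.space W'.spaceᗮ :=
  HS.compCLM _ _ _ (grNumerator W W' A) (grDenominator W W' A).inverse

theorem grDenominator_eq (W W' : GrRes Hp) (A : HS W.space W.spaceᗮ) :
    grDenominator W W' A = W'.space.orthogonalProjectionOnto ∘L graphMap A.toCLM := by
  rw [graphMap, ContinuousLinearMap.comp_add]; rfl

theorem toCLM_grNumerator (W W' : GrRes Hp) (A : HS W.space W.spaceᗮ) :
    (grNumerator W W' A).toCLM = W'.spaceᗮ.orthogonalProjectionOnto ∘L graphMap A.toCLM := by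
  rw [graphMap, ContinuousLinearMap.comp_add]; rfl

theorem grDenominator_comp {V W : GrRes Hp} (h : V ∈ grDom W) (W' : GrRes Hp) :
    grDenominator W W' (grChart W V) ∘L
      (W.space.orthogonalProjectionOnto ∘L V.space.subtypeL) =
      W'.space.orthogonalProjectionOnto ∘L V.space.subtypeL := by
  rw [grDenominator_eq, toCLM_grChart, ContinuousLinearMap.comp_assoc, graphMap_grChartOp h]

theorem mem_grDom_iff_grDenominator {V W : GrRes Hp} (h : V ∈ grDom W) (W' : GrRes Hp) :
    V ∈ grDom W' ↔ (grDenominator W W' (grChart W V)).IsInvertible := by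
  rw [mem_grDom_iff, ← grDenominator_comp h]
  obtain ⟨e, he⟩ := mem_grDom_iff.1 h
  rw [← he, ContinuousLinearMap.isInvertible_comp_equiv]

/-- Both projections of `V` factor as a projection of `1 + A` followed on the right by the
isomorphism `P_W|_V`, which cancels in the quotient. -/
theorem grTransition_grChart {V W : GrRes Hp} (h : V ∈ grDom W) (W' : GrRes Hp) :
    grTransition W W' (grChart W V) = grChart W' V := by
  ext1
  rw [toCLM_grChart, grTransition, HS.toCLM_compCLM, grChartOp, ← grDenominator_comp h,
    (mem_grDom_iff.1 h).inverse_comp_of_right, toCLM_grNumerator, toCLM_grChart]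
  have h1 : W'.spaceᗮ.orthogonalProjectionOnto ∘L V.space.subtypeL =
      W'.spaceᗮ.orthogonalProjectionOnto ∘L (graphMap (grChartOp W V) ∘L
        (W.space.orthogonalProjectionOnto ∘L V.space.subtypeL)) := by
    rw [graphMap_grChartOp h]
  rw [h1]
  obtain ⟨e, he⟩ := mem_grDom_iff.1 h
  rw [← he, ContinuousLinearMap.inverse_equiv]
  ext x
  simp

theorem contDiff_grDenominator (W W' : GrRes Hp) : ContDiff ℂ ∞ (grDenominator W W') :=
  contDiff_const.add (contDiff_const.clm_comp (HS.toCLML W.space W.spaceᗮ).contDiff)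

theorem isOpen_grDenominator (W W' : GrRes Hp) :
    IsOpen {A | (grDenominator W W' A).IsInvertible} :=
  (ContinuousLinearEquiv.isOpen (𝕜 := ℂ) (E := W.space) (F := W'.space)).preimage
    (contDiff_grDenominator W W').continuous

theorem contDiffOn_grTransition (W W' : GrRes Hp) :
    ContDiffOn ℂ ∞ (grTransition W W') {A | (grDenominator W W' A).IsInvertible} := by
  intro A hA
  have h1 : ContDiffAt ℂ ∞ (fun A => (grDenominator W W' A).inverse) A :=
    (ContinuousLinearMap.IsInvertible.contDiffAt_map_inverse hA).comp A
      (contDiff_grDenominator W W').contDiffAt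
  have h2 : ContDiffAt ℂ ∞ (grNumerator W W') A :=
    contDiffAt_const.add (HS.clmComp _).contDiff.contDiffAt
  exact ((HS.compCLM _ _ _).isBoundedBilinearMap.contDiff.contDiffAt.comp A
    (h2.prodMk h1)).contDiffWithinAt

theorem image_grChart_inter_grDom (W W' : GrRes Hp) :
    grChart W '' (grDom W ∩ grDom W') = {A | (grDenominator W W' A).IsInvertible} := by
  ext A
  constructor
  · rintro ⟨V, ⟨hV, hV'⟩, rfl⟩
    exact (mem_grDom_iff_grDenominator hV W').1 hV'
  · intro hA
    refine ⟨W.graph A, ⟨W.graph_mem_grDom A, ?_⟩, grChart_graph W A⟩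
    rw [mem_grDom_iff_grDenominator (W.graph_mem_grDom A), grChart_graph]
    exact hA

variable (Hp) in
theorem isSmoothAtlas_grChart :
    IsSmoothAtlas (E := fun W : GrRes Hp => HS W.space W.spaceᗮ) grDom grChart where
  cover := iUnion_eq_univ_iff.2 fun W => ⟨W, mem_grDom_self W⟩
  injOn := injOn_grChart
  isOpen_image W W' := by
    rw [image_grChart_inter_grDom]
    exact isOpen_grDenominator W W'
  smooth_transition W W' := ⟨grTransition W W', by
    rw [image_grChart_inter_grDom]
    exact (contDiffOn_grTransition W W').restrict_scalars ℝ,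
    fun V hV => grTransition_grChart hV.1 W'⟩

end Grassmannian

section PartialIsometries

variable {H : Type*} [NormedAddCommGroup H] [InnerProductSpace ℂ H] [CompleteSpace H]
  (Hp : Submodule ℂ H) [CompleteSpace Hp]

/-! ### Compressions and dilations -/

/-- The compression `x ↦ P₊ x|_{Hp}`. -/
def compress : (H →L[ℂ] H) →L[ℂ] (Hp →L[ℂ] Hp) :=
  (ContinuousLinearMap.compL ℂ Hp H Hp Hp.orthogonalProjectionOnto) ∘L
    ((ContinuousLinearMap.compL ℂ Hp H H).flip Hp.subtypeL)

/-- The extension by zero `T ↦ T P₊`. -/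
def dilate : (Hp →L[ℂ] Hp) →L[ℂ] (H →L[ℂ] H) :=
  (ContinuousLinearMap.compL ℂ H Hp H Hp.subtypeL) ∘L
    ((ContinuousLinearMap.compL ℂ H Hp Hp).flip Hp.orthogonalProjectionOnto)

theorem compress_apply (x : H →L[ℂ] H) :
    compress Hp x = Hp.orthogonalProjectionOnto ∘L x ∘L Hp.subtypeL := rfl

theorem dilate_apply (T : Hp →L[ℂ] Hp) :
    dilate Hp T = Hp.subtypeL ∘L T ∘L Hp.orthogonalProjectionOnto := rfl

theorem compress_dilate (T : Hp →L[ℂ] Hp) : compress Hp (dilate Hp T) = T := by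
  ext x
  simp [compress_apply, dilate_apply]

theorem dilate_compress (x : H →L[ℂ] H) :
    dilate Hp (compress Hp x) = Hp.starProjection * x * Hp.starProjection := rfl

theorem dilate_one : dilate Hp 1 = Hp.starProjection := rfl

theorem dilate_mul (S T : Hp →L[ℂ] Hp) : dilate Hp (S * T) = dilate Hp S * dilate Hp T := by
  ext x
  simp [dilate_apply]

theorem star_dilate (T : Hp →L[ℂ] Hp) : star (dilate Hp T) = dilate Hp (star T) := by
  simp only [dilate_apply, ContinuousLinearMap.star_eq_adjoint, ContinuousLinearMap.adjoint_comp,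
    Submodule.adjoint_subtypeL, Submodule.adjoint_orthogonalProjectionOnto]
  rfl

theorem dilate_injective : Function.Injective (dilate Hp) :=
  Function.LeftInverse.injective (compress_dilate Hp)

/-! ### Partial isometries and unitary operators -/

/-- By the C*-identity it suffices that `(up - u)*(up - u)` vanishes for `p = u*u`; it expands into
powers of the idempotent `p`. -/
theorem mul_star_mul_self_of_isStarProjection {u : H →L[ℂ] H}
    (h : IsStarProjection (star u * u)) : u * (star u * u) = u := by
  have h1 : star u * u * (star u * u) = star u * u := h.isIdempotentElem
  rw [← sub_eq_zero, ← CStarRing.star_mul_self_eq_zero_iff]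
  have : star (u * (star u * u) - u) * (u * (star u * u) - u) =
      star u * u * (star u * u) * (star u * u) - star u * u * (star u * u) -
        (star u * u * (star u * u) - star u * u) := by
    simp only [star_sub, star_mul, star_star]
    noncomm_ring
  rw [this, h1, h1, sub_self]

variable {Hp} {a b u : H →L[ℂ] H}

/-- Conjugation by `a` and `b` turns the outer `P₊` into `uu*` and `u*u`, which `u` absorbs. Thus
compressing `a* u b` to `Hp` loses nothing. -/
theorem starProjection_mul_mul_starProjection (ha : a ∈ unitary (H →L[ℂ] H))
    (hb : b ∈ unitary (H →L[ℂ] H)) (hu : u * (star u * u) = u)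
    (hs : b * Hp.starProjection * star b = star u * u)
    (ht : a * Hp.starProjection * star a = u * star u) :
    Hp.starProjection * (star a * u * b) * Hp.starProjection = star a * u * b := by
  have ha' := Unitary.star_mul_self_of_mem ha
  have hb' := Unitary.star_mul_self_of_mem hb
  calc Hp.starProjection * (star a * u * b) * Hp.starProjection
      = (star a * a) * Hp.starProjection * (star a * u * b) * Hp.starProjection *
          (star b * b) := by rw [ha', hb', one_mul, mul_one]
    _ = star a * (a * Hp.starProjection * star a) * u * (b * Hp.starProjection * star b) * b := by
        simp only [mul_assoc]
    _ = star a * (u * (star u * u) * (star u * u)) * b := by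
        rw [hs, ht]; simp only [mul_assoc]
    _ = star a * u * b := by rw [hu, hu]

theorem compress_mem_unitary (ha : a ∈ unitary (H →L[ℂ] H))
    (hb : b ∈ unitary (H →L[ℂ] H)) (hu : u * (star u * u) = u)
    (hs : b * Hp.starProjection * star b = star u * u)
    (ht : a * Hp.starProjection * star a = u * star u) :
    compress Hp (star a * u * b) ∈ unitary (Hp →L[ℂ] Hp) := by
  have h := starProjection_mul_mul_starProjection ha hb hu hs ht
  have ha' := Unitary.star_mul_self_of_mem ha
  have hb' := Unitary.star_mul_self_of_mem hb
  have ha'' := Unitary.mul_star_self_of_mem ha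
  have hb'' := Unitary.mul_star_self_of_mem hb
  rw [Unitary.mem_iff]
  constructor
  · apply dilate_injective
    rw [dilate_mul, ← star_dilate, dilate_compress, h, dilate_one]
    calc star (star a * u * b) * (star a * u * b) = star b * star u * (a * star a) * u * b := by
          simp only [star_mul, star_star, mul_assoc]
      _ = star b * (b * Hp.starProjection * star b) * b := by
          rw [ha'', hs]; simp only [mul_assoc, mul_one]
      _ = (star b * b) * Hp.starProjection * (star b * b) := by simp only [mul_assoc]
      _ = Hp.starProjection := by rw [hb', one_mul, mul_one]
  · apply dilate_injective
    rw [dilate_mul, ← star_dilate, dilate_compress, h, dilate_one]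
    calc (star a * u * b) * star (star a * u * b) = star a * u * (b * star b) * star u * a := by
          simp only [star_mul, star_star, mul_assoc]
      _ = star a * (a * Hp.starProjection * star a) * a := by
          rw [hb'', ht]; simp only [mul_assoc, mul_one]
      _ = (star a * a) * Hp.starProjection * (star a * a) := by simp only [mul_assoc]
      _ = Hp.starProjection := by rw [ha', one_mul, mul_one]

theorem mul_dilate_compress_mul_star (ha : a ∈ unitary (H →L[ℂ] H))
    (hb : b ∈ unitary (H →L[ℂ] H)) (hu : u * (star u * u) = u)
    (hs : b * Hp.starProjection * star b = star u * u)
    (ht : a * Hp.starProjection * star a = u * star u) :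
    a * dilate Hp (compress Hp (star a * u * b)) * star b = u := by
  rw [dilate_compress, starProjection_mul_mul_starProjection ha hb hu hs ht]
  calc a * (star a * u * b) * star b = (a * star a) * u * (b * star b) := by
        simp only [mul_assoc]
    _ = u := by
        rw [Unitary.mul_star_self_of_mem ha, Unitary.mul_star_self_of_mem hb, one_mul, mul_one]

theorem compress_star_mul_mul (ha : a ∈ unitary (H →L[ℂ] H))
    (hb : b ∈ unitary (H →L[ℂ] H)) (T : Hp →L[ℂ] Hp) :
    compress Hp (star a * (a * dilate Hp T * star b) * b) = T := by
  have : star a * (a * dilate Hp T * star b) * b =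
      (star a * a) * dilate Hp T * (star b * b) := by simp only [mul_assoc]
  rw [this, Unitary.star_mul_self_of_mem ha, Unitary.star_mul_self_of_mem hb, one_mul, mul_one,
    compress_dilate]

theorem star_mul_self_dilate (ha : a ∈ unitary (H →L[ℂ] H))
    {T : Hp →L[ℂ] Hp} (hT : T ∈ unitary (Hp →L[ℂ] Hp)) :
    star (a * dilate Hp T * star b) * (a * dilate Hp T * star b) =
      b * Hp.starProjection * star b := by
  calc star (a * dilate Hp T * star b) * (a * dilate Hp T * star b)
      = b * (star (dilate Hp T) * (star a * a) * dilate Hp T) * star b := by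
        simp only [star_mul, star_star, mul_assoc]
    _ = b * Hp.starProjection * star b := by
        rw [Unitary.star_mul_self_of_mem ha, mul_one, star_dilate, ← dilate_mul,
          Unitary.star_mul_self_of_mem hT, dilate_one]

theorem self_mul_star_dilate (hb : b ∈ unitary (H →L[ℂ] H))
    {T : Hp →L[ℂ] Hp} (hT : T ∈ unitary (Hp →L[ℂ] Hp)) :
    (a * dilate Hp T * star b) * star (a * dilate Hp T * star b) =
      a * Hp.starProjection * star a := by
  calc (a * dilate Hp T * star b) * star (a * dilate Hp T * star b)
      = a * (dilate Hp T * (star b * b) * star (dilate Hp T)) * star a := by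
        simp only [star_mul, star_star, mul_assoc]
    _ = a * Hp.starProjection * star a := by
        rw [Unitary.star_mul_self_of_mem hb, mul_one, star_dilate, ← dilate_mul,
          Unitary.mul_star_self_of_mem hT, dilate_one]

/-- The residual `x - a P₊ a* x` equals `a (a*x - P₊ a*x)`, and a unitary operator preserves
orthogonality to `Hp`. -/
theorem starProjection_eq_of_map_eq (ha : a ∈ unitary (H →L[ℂ] H))
    {V : Submodule ℂ H} [CompleteSpace V]
    (h : Hp.map (a : H →ₗ[ℂ] H) = V) :
    V.starProjection = a * Hp.starProjection * star a := by
  subst h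
  ext x
  refine Submodule.eq_starProjection_of_mem_orthogonal
    ⟨_, Submodule.starProjection_apply_mem Hp (star a x), rfl⟩ ?_
  rw [Submodule.mem_orthogonal]
  rintro _ ⟨y, hy, rfl⟩
  have hx : x = a (star a x) :=
    (DFunLike.congr_fun (Unitary.mul_star_self_of_mem ha) x).symm
  have h1 : x - (a * Hp.starProjection * star a) x =
      a (star a x - Hp.starProjection (star a x)) := by
    rw [map_sub, ← hx]; rfl
  have h2 : star a (a y) = y := DFunLike.congr_fun (Unitary.star_mul_self_of_mem ha) y
  rw [h1]
  change ⟪a y, _⟫_ℂ = 0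
  rw [← ContinuousLinearMap.adjoint_inner_left, ← ContinuousLinearMap.star_eq_adjoint, h2]
  exact Submodule.sub_starProjection_mem_orthogonal _ y hy

end PartialIsometries

section Groupoid

variable {H : Type*} [NormedAddCommGroup H] [InnerProductSpace ℂ H] [CompleteSpace H]
  {Hp : Submodule ℂ H} [CompleteSpace Hp]

namespace PartIsoRes

theorem ext {u v : PartIsoRes Hp} (h : u.1 = v.1) : u = v := Subtype.ext h

theorem mul_star_mul_self (u : PartIsoRes Hp) : u.1 * (star u.1 * u.1) = u.1 :=
  mul_star_mul_self_of_isStarProjection u.2.1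

end PartIsoRes

theorem transportOp_eq (σγ σβ : GrRes Hp → URes Hp) (u : PartIsoRes Hp) :
    transportOp σγ σβ u = compress Hp
      (star (σγ u.target).toLRes.toCLM * u.1 * (σβ u.source).toLRes.toCLM) := rfl

/-! ### Partial isometries in terms of cross-sections -/

section CrossSections

variable {Ωβ Ωγ : Set (GrRes Hp)} {σβ σγ : GrRes Hp → URes Hp}

theorem IsSmoothCrossSection.starProjection_eq (hβ : IsSmoothCrossSection Ωβ σβ) {V : GrRes Hp}
    (hV : V ∈ Ωβ) : (σβ V).toLRes.toCLM * Hp.starProjection * star (σβ V).toLRes.toCLM =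
      V.space.starProjection :=
  (starProjection_eq_of_map_eq (σβ V).2 (hβ.map_eq V hV)).symm

theorem transportOp_mem_unitary (hβ : IsSmoothCrossSection Ωβ σβ)
    (hγ : IsSmoothCrossSection Ωγ σγ) {u : PartIsoRes Hp} (hs : u.source ∈ Ωβ)
    (ht : u.target ∈ Ωγ) : transportOp σγ σβ u ∈ unitary (Hp →L[ℂ] Hp) := by
  rw [transportOp_eq]
  exact compress_mem_unitary (σγ u.target).2 (σβ u.source).2 u.mul_star_mul_self
    ((hβ.starProjection_eq hs).trans u.starProjection_source)
    ((hγ.starProjection_eq ht).trans u.starProjection_target)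

theorem coe_transport (hβ : IsSmoothCrossSection Ωβ σβ)
    (hγ : IsSmoothCrossSection Ωγ σγ) {u : PartIsoRes Hp} (hs : u.source ∈ Ωβ)
    (ht : u.target ∈ Ωγ) : (transport σγ σβ u : Hp →L[ℂ] Hp) = transportOp σγ σβ u := by
  rw [transport, dif_pos (transportOp_mem_unitary hβ hγ hs ht)]

theorem PartIsoRes.eq_mul_dilate_mul (hβ : IsSmoothCrossSection Ωβ σβ)
    (hγ : IsSmoothCrossSection Ωγ σγ) {u : PartIsoRes Hp} (hs : u.source ∈ Ωβ)
    (ht : u.target ∈ Ωγ) : (σγ u.target).toLRes.toCLM *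
      dilate Hp (transport σγ σβ u : Hp →L[ℂ] Hp) * star (σβ u.source).toLRes.toCLM = u.1 := by
  rw [coe_transport hβ hγ hs ht, transportOp_eq]
  exact mul_dilate_compress_mul_star (σγ u.target).2 (σβ u.source).2 u.mul_star_mul_self
    ((hβ.starProjection_eq hs).trans u.starProjection_source)
    ((hγ.starProjection_eq ht).trans u.starProjection_target)

/-- The witness `σγ(V') T σβ(V)*` has initial and final projections `b P₊ b*` and `a P₊ a*`, because
`T` is unitary on `Hp`. -/
theorem exists_partIsoRes (hβ : IsSmoothCrossSection Ωβ σβ)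
    (hγ : IsSmoothCrossSection Ωγ σγ) {V V' : GrRes Hp} (hV : V ∈ Ωβ) (hV' : V' ∈ Ωγ)
    (T : UGroup Hp) :
    ∃ u : PartIsoRes Hp, u.source = V ∧ u.target = V' ∧ transport σγ σβ u = T := by
  let x : H →L[ℂ] H := (σγ V').toLRes.toCLM * dilate Hp T * star (σβ V).toLRes.toCLM
  have hs : V.space.starProjection = star x * x :=
    (hβ.starProjection_eq hV).symm.trans (star_mul_self_dilate (σγ V').2 T.2).symm
  have ht : V'.space.starProjection = x * star x :=
    (hγ.starProjection_eq hV').symm.trans (self_mul_star_dilate (σβ V).2 T.2).symm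
  let u : PartIsoRes Hp := ⟨x, hs ▸ isStarProjection_starProjection,
    ht ▸ isStarProjection_starProjection, ⟨V, hs⟩, ⟨V', ht⟩⟩
  have hus : u.source = V := GrRes.ext_starProjection (u.starProjection_source.trans hs.symm)
  have hut : u.target = V' := GrRes.ext_starProjection (u.starProjection_target.trans ht.symm)
  refine ⟨u, hus, hut, Subtype.ext ?_⟩
  rw [coe_transport hβ hγ (hus ▸ hV) (hut ▸ hV'), transportOp_eq, hus, hut]
  exact compress_star_mul_mul (σγ V').2 (σβ V).2 (T : Hp →L[ℂ] Hp)

end CrossSections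

/-! ### Coordinate expressions of cross-sections -/

variable (Hp) in
/-- The inclusion of `L_res` into the bounded operators. -/
def LRes.toCLML : LRes Hp →L[ℂ] H →L[ℂ] H :=
  LinearMap.mkContinuous ⟨⟨LRes.toCLM, fun _ _ => rfl⟩, fun _ _ => rfl⟩ 1
    fun x => (le_max_left ‖x.toCLM‖ ‖x.comm‖).trans_eq (one_mul _).symm

/-- Only smoothness in operator norm is used below, so the finer norm of `LRes` is forgotten. -/
theorem IsSmoothCrossSection.exists_contDiffOn {Ω : Set (GrRes Hp)} {σ : GrRes Hp → URes Hp}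
    (h : IsSmoothCrossSection Ω σ) (W : GrRes Hp) : ∃ g : HS W.space W.spaceᗮ → H →L[ℂ] H,
      ContDiffOn ℝ ∞ g (grChart W '' (Ω ∩ grDom W)) ∧
        ∀ V ∈ Ω ∩ grDom W, g (grChart W V) = (σ V).toLRes.toCLM := by
  obtain ⟨g, hg, hgσ⟩ := h.smooth W
  refine ⟨fun A => (g A).toCLM, ?_, fun V hV => congrArg LRes.toCLM (hgσ V hV)⟩
  exact ((LRes.toCLML Hp).restrictScalars ℝ).contDiff.comp_contDiffOn hg

/-- The adjoint is conjugate linear, so smoothness is taken over `ℝ`. -/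
theorem ContDiffOn.star_clm {E : Type*} [NormedAddCommGroup E] [NormedSpace ℝ E]
    {f : E → H →L[ℂ] H} {s : Set E} (hf : ContDiffOn ℝ ∞ f s) :
    ContDiffOn ℝ ∞ (fun x => star (f x)) s :=
  (starL' ℝ : (H →L[ℂ] H) ≃L[ℝ] (H →L[ℂ] H)).contDiff.comp_contDiffOn hf

theorem ContDiffOn.mul_clm {E : Type*} [NormedAddCommGroup E] [NormedSpace ℝ E]
    {f g : E → H →L[ℂ] H} {s : Set E} (hf : ContDiffOn ℝ ∞ f s) (hg : ContDiffOn ℝ ∞ g s) :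
    ContDiffOn ℝ ∞ (fun x => f x * g x) s :=
  (ContinuousLinearMap.compL ℂ H H H).isBoundedBilinearMap.contDiff.restrict_scalars
    ℝ |>.comp_contDiffOn (hf.prodMk hg)

variable (Hp) in
theorem contDiff_compress : ContDiff ℝ ∞ (compress Hp) :=
  (ContinuousLinearMap.contDiff (𝕜 := ℂ) (E := H →L[ℂ] H) (F := Hp →L[ℂ] Hp)
    (compress Hp)).restrict_scalars ℝ

variable (Hp) in
theorem contDiff_dilate : ContDiff ℝ ∞ (dilate Hp) :=
  (ContinuousLinearMap.contDiff (𝕜 := ℂ) (E := Hp →L[ℂ] Hp) (F := H →L[ℂ] H)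
    (dilate Hp)).restrict_scalars ℝ

theorem contDiffOn_mul_dilate_mul_star {E F G : Type*} [NormedAddCommGroup E] [NormedSpace ℝ E]
    [NormedAddCommGroup F] [NormedSpace ℝ F] [NormedAddCommGroup G] [NormedSpace ℝ G]
    {f : E → H →L[ℂ] H} {g : F → H →L[ℂ] H} {h : G → Hp →L[ℂ] Hp} {s : Set E} {t : Set F}
    {r : Set G} (hf : ContDiffOn ℝ ∞ f s) (hg : ContDiffOn ℝ ∞ g t) (hh : ContDiffOn ℝ ∞ h r) :
    ContDiffOn ℝ ∞ (fun x : E × F × G => f x.1 * dilate Hp (h x.2.2) * star (g x.2.1))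
      (s ×ˢ t ×ˢ r) := by
  have h1 : ContDiffOn ℝ ∞ (fun x : E × F × G => f x.1) (s ×ˢ t ×ˢ r) :=
    hf.comp contDiffOn_fst fun x hx => hx.1
  have h2 : ContDiffOn ℝ ∞ (fun x : E × F × G => g x.2.1) (s ×ˢ t ×ˢ r) :=
    hg.comp contDiff_snd.fst.contDiffOn fun x hx => hx.2.1
  have h3 : ContDiffOn ℝ ∞ (fun x : E × F × G => h x.2.2) (s ×ˢ t ×ˢ r) :=
    hh.comp contDiff_snd.snd.contDiffOn fun x hx => hx.2.2
  have h4 : ContDiffOn ℝ ∞ (fun x : E × F × G => dilate Hp (h x.2.2)) (s ×ˢ t ×ˢ r) :=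
    (contDiff_dilate Hp).comp_contDiffOn h3
  exact (h1.mul_clm h4).mul_clm h2.star_clm

theorem isOpen_image_grChart {W : GrRes Hp} {Ω : Set (GrRes Hp)} (hΩ : IsOpen[grTopology Hp] Ω)
    (h : Ω ⊆ grDom W) : IsOpen (grChart W '' Ω) := by
  have := (isSmoothAtlas_grChart Hp).isOpen_image_inter hΩ W
  rwa [inter_eq_self_of_subset_right h] at this

instance (K : Type*) [NormedAddCommGroup K] [InnerProductSpace ℂ K] [CompleteSpace K] :
    CompleteSpace (UAlg K) := by
  have : IsClosed (skewAdjoint.submodule ℝ (K →L[ℂ] K) : Set (K →L[ℂ] K)) :=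
    isClosed_eq (f := fun x : K →L[ℂ] K => star x) (g := fun x => -x) continuous_star continuous_neg
  exact this.completeSpace_coe

/-! ### The atlas of the groupoid of partial isometries -/

section ResAtlas

variable {I J : Type*} {ψ : I → OpenPartialHomeomorph (UGroup Hp) (UAlg Hp)} {W : J → GrRes Hp}
  {Ω : J → Set (GrRes Hp)} {σ : J → GrRes Hp → URes Hp}

theorem mem_resDom_iff (hσ : ∀ β, IsSmoothCrossSection (Ω β) (σ β)) {i : I × J × J}
    {u : PartIsoRes Hp} : u ∈ resDom ψ Ω σ i ↔ u.source ∈ Ω i.2.1 ∧ u.target ∈ Ω i.2.2 ∧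
      transport (σ i.2.2) (σ i.2.1) u ∈ (ψ i.1).source :=
  ⟨fun h => ⟨h.1, h.2.1, h.2.2.2⟩, fun h => ⟨h.1, h.2.1,
    transportOp_mem_unitary (hσ _) (hσ _) h.1 h.2.1, h.2.2⟩⟩

theorem iUnion_resDom (hψcover : ⋃ α, (ψ α).source = univ) (hΩcover : ⋃ β, Ω β = univ)
    (hσ : ∀ β, IsSmoothCrossSection (Ω β) (σ β)) : ⋃ i, resDom ψ Ω σ i = univ := by
  refine iUnion_eq_univ_iff.2 fun u => ?_
  obtain ⟨β, hβ⟩ := iUnion_eq_univ_iff.1 hΩcover u.source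
  obtain ⟨γ, hγ⟩ := iUnion_eq_univ_iff.1 hΩcover u.target
  obtain ⟨α, hα⟩ := iUnion_eq_univ_iff.1 hψcover (transport (σ γ) (σ β) u)
  exact ⟨(α, β, γ), (mem_resDom_iff hσ).2 ⟨hβ, hγ, hα⟩⟩

theorem injOn_resChart (hΩdom : ∀ β, Ω β ⊆ grDom (W β))
    (hσ : ∀ β, IsSmoothCrossSection (Ω β) (σ β)) (i : I × J × J) :
    InjOn (resChart ψ W σ i) (resDom ψ Ω σ i) := by
  intro u hu v hv h
  obtain ⟨hus, hut, huT⟩ := (mem_resDom_iff hσ).1 hu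
  obtain ⟨hvs, hvt, hvT⟩ := (mem_resDom_iff hσ).1 hv
  simp only [resChart, Prod.mk.injEq] at h
  have h1 : u.target = v.target := injOn_grChart _ (hΩdom _ hut) (hΩdom _ hvt) h.1
  have h2 : u.source = v.source := injOn_grChart _ (hΩdom _ hus) (hΩdom _ hvs) h.2.1
  have h3 := (ψ i.1).injOn huT hvT h.2.2
  apply PartIsoRes.ext
  rw [← PartIsoRes.eq_mul_dilate_mul (hσ _) (hσ _) hus hut,
    ← PartIsoRes.eq_mul_dilate_mul (hσ _) (hσ _) hvs hvt, h1, h2, h3]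

/-- The coordinates of all partial isometries in `Ω_{αβγ}` whose source and target belong to
`Ω_{β'}` and `Ω_{γ'}`. -/
theorem image_resChart_inter (hσ : ∀ β, IsSmoothCrossSection (Ω β) (σ β)) (i : I × J × J)
    (S S' : Set (GrRes Hp)) :
    resChart ψ W σ i '' (resDom ψ Ω σ i ∩ {u | u.source ∈ S ∧ u.target ∈ S'}) =
      (grChart (W i.2.2) '' (Ω i.2.2 ∩ S')) ×ˢ (grChart (W i.2.1) '' (Ω i.2.1 ∩ S)) ×ˢ
        (ψ i.1).target := by
  ext ⟨A, B, X⟩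
  constructor
  · rintro ⟨u, ⟨hu, hS, hS'⟩, h⟩
    obtain ⟨hus, hut, huT⟩ := (mem_resDom_iff hσ).1 hu
    simp only [resChart, Prod.mk.injEq] at h
    obtain ⟨rfl, rfl, rfl⟩ := h
    exact ⟨⟨_, ⟨hut, hS'⟩, rfl⟩, ⟨_, ⟨hus, hS⟩, rfl⟩, (ψ i.1).map_source huT⟩
  · rintro ⟨⟨V', hV', hA⟩, ⟨V, hV, hB⟩, hX⟩
    obtain ⟨u, hus, hut, huT⟩ := exists_partIsoRes (hσ _) (hσ _) hV.1 hV'.1 ((ψ i.1).symm X)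
    subst hus hut
    refine ⟨u, ⟨(mem_resDom_iff hσ).2 ⟨hV.1, hV'.1, huT ▸ (ψ i.1).map_target hX⟩, hV.2, hV'.2⟩, ?_⟩
    simp only [resChart, huT, hA, hB, (ψ i.1).right_inv hX]

theorem smoothOnAtlas_coe (hψ : ∀ α, IsSmoothUnitaryChart (ψ α))
    (hΩdom : ∀ β, Ω β ⊆ grDom (W β)) (hσ : ∀ β, IsSmoothCrossSection (Ω β) (σ β)) :
    SmoothOnAtlas (E := fun i : I × J × J => resModel W i.2.1 i.2.2) (resDom ψ Ω σ)
      (resChart ψ W σ) (fun u => u.1) univ := by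
  intro i
  obtain ⟨gβ, hgβ, hgβσ⟩ := (hσ i.2.1).exists_contDiffOn (W i.2.1)
  obtain ⟨gγ, hgγ, hgγσ⟩ := (hσ i.2.2).exists_contDiffOn (W i.2.2)
  refine ⟨fun x => gγ x.1 * dilate Hp ((ψ i.1).symm x.2.2 : Hp →L[ℂ] Hp) * star (gβ x.2.1),
    ?_, ?_⟩
  · have h : resChart ψ W σ i '' (univ ∩ resDom ψ Ω σ i) =
        (grChart (W i.2.2) '' Ω i.2.2) ×ˢ (grChart (W i.2.1) '' Ω i.2.1) ×ˢ (ψ i.1).target := by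
      simpa [inter_comm] using image_resChart_inter (W := W) (ψ := ψ) hσ i univ univ
    rw [h]
    rw [inter_eq_self_of_subset_left (hΩdom _)] at hgβ hgγ
    have key := contDiffOn_mul_dilate_mul_star hgγ hgβ (hψ i.1).smooth_symm
    exact key
  · rintro u ⟨-, hu⟩
    obtain ⟨hus, hut, huT⟩ := (mem_resDom_iff hσ).1 hu
    simp only [resChart, hgγσ _ ⟨hut, hΩdom _ hut⟩, hgβσ _ ⟨hus, hΩdom _ hus⟩,
      (ψ i.1).left_inv huT]
    exact PartIsoRes.eq_mul_dilate_mul (hσ _) (hσ _) hus hut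

open Classical in
/-- The extension of a chart of the unitary group by zero to all bounded operators. -/
def extendChart (e : OpenPartialHomeomorph (UGroup Hp) (UAlg Hp)) (T : Hp →L[ℂ] Hp) : UAlg Hp :=
  if h : T ∈ unitary (Hp →L[ℂ] Hp) then e ⟨T, h⟩ else 0

theorem extendChart_coe (e : OpenPartialHomeomorph (UGroup Hp) (UAlg Hp)) (T : UGroup Hp) :
    extendChart e (T : Hp →L[ℂ] Hp) = e T := by
  rw [extendChart, dif_pos T.2]

/-- The unitary group is not open among the operators, so `extendChart e` need not be smooth. Near
each point it agrees with a smooth local extension `f` at the values of `τ`, which are unitary on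
`s`. -/
theorem IsSmoothUnitaryChart.contDiffOn_extendChart_comp
    {e : OpenPartialHomeomorph (UGroup Hp) (UAlg Hp)} (he : IsSmoothUnitaryChart e)
    {E : Type*} [NormedAddCommGroup E] [NormedSpace ℝ E] {τ : E → Hp →L[ℂ] Hp} {s : Set E}
    (hτ : ContDiffOn ℝ ∞ τ s) (hs : ∀ x ∈ s, ∃ T ∈ e.source, (T : Hp →L[ℂ] Hp) = τ x) :
    ContDiffOn ℝ ∞ (fun x => extendChart e (τ x)) s := by
  intro x hx
  obtain ⟨T, hT, hTx⟩ := hs x hx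
  obtain ⟨N, hN, hTN, f, hf, hfe⟩ := he.smooth T hT
  rw [hTx] at hTN
  have h1 : ContDiffWithinAt ℝ ∞ (fun x => f (τ x)) s x :=
    (hf.contDiffAt (hN.mem_nhds hTN)).comp_contDiffWithinAt x (hτ x hx)
  have key : ∀ y ∈ s, τ y ∈ N → extendChart e (τ y) = f (τ y) := fun y hy hyN => by
    obtain ⟨T', hT', hTy⟩ := hs y hy
    rw [← hTy] at hyN ⊢
    rw [extendChart_coe, hfe T' hT' hyN]
  refine h1.congr_of_eventuallyEq ?_ (key x hx hTN)
  filter_upwards [(hτ x hx).continuousWithinAt.preimage_mem_nhdsWithin (hN.mem_nhds hTN),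
    self_mem_nhdsWithin] with y hyN hy
  exact key y hy hyN

/-- The coordinate expression of `transportOp` for one pair of cross-sections in a chart for
another one. -/
theorem exists_contDiffOn_transportOp (hψ : ∀ α, IsSmoothUnitaryChart (ψ α))
    (hΩdom : ∀ β, Ω β ⊆ grDom (W β)) (hσ : ∀ β, IsSmoothCrossSection (Ω β) (σ β))
    (i : I × J × J) (β γ : J) : ∃ τ : resModel W i.2.1 i.2.2 → Hp →L[ℂ] Hp,
      ContDiffOn ℝ ∞ τ (resChart ψ W σ i '' (resDom ψ Ω σ i ∩
        {u | u.source ∈ Ω β ∧ u.target ∈ Ω γ})) ∧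
      ∀ u ∈ resDom ψ Ω σ i, u.source ∈ Ω β → u.target ∈ Ω γ →
        τ (resChart ψ W σ i u) = transport (σ γ) (σ β) u := by
  obtain ⟨gβ, hgβ, hgβσ⟩ := (hσ i.2.1).exists_contDiffOn (W i.2.1)
  obtain ⟨gγ, hgγ, hgγσ⟩ := (hσ i.2.2).exists_contDiffOn (W i.2.2)
  obtain ⟨kβ, hkβ, hkβσ⟩ := (hσ β).exists_contDiffOn (W i.2.1)
  obtain ⟨kγ, hkγ, hkγσ⟩ := (hσ γ).exists_contDiffOn (W i.2.2)
  -- The inner factor rebuilds `u` from its coordinates in the chart `i`; the outer factors `kγ`,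
  -- `kβ` are the other two cross-sections read in the Grassmannian charts of `i`.
  refine ⟨fun x => compress Hp (star (kγ x.1) *
    (gγ x.1 * dilate Hp ((ψ i.1).symm x.2.2 : Hp →L[ℂ] Hp) * star (gβ x.2.1)) * kβ x.2.1), ?_, ?_⟩
  · rw [image_resChart_inter hσ]
    refine (contDiff_compress Hp).comp_contDiffOn ((ContDiffOn.mul_clm ?_ ?_).mul_clm ?_)
    · have key : grChart (W i.2.2) '' (Ω i.2.2 ∩ Ω γ) ⊆ grChart (W i.2.2) ''
          (Ω γ ∩ grDom (W i.2.2)) := image_mono fun V hV => ⟨hV.2, hΩdom _ hV.1⟩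
      exact (hkγ.comp contDiffOn_fst fun x hx => key hx.1).star_clm
    · have key := contDiffOn_mul_dilate_mul_star hgγ hgβ (hψ i.1).smooth_symm
      refine key.mono ?_
      exact prod_mono (image_mono fun V hV => ⟨hV.1, hΩdom _ hV.1⟩)
        (prod_mono (image_mono fun V hV => ⟨hV.1, hΩdom _ hV.1⟩) subset_rfl)
    · have key : grChart (W i.2.1) '' (Ω i.2.1 ∩ Ω β) ⊆ grChart (W i.2.1) ''
          (Ω β ∩ grDom (W i.2.1)) := image_mono fun V hV => ⟨hV.2, hΩdom _ hV.1⟩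
      exact hkβ.comp contDiff_snd.fst.contDiffOn fun x hx => key hx.2.1
  · intro u hu hs ht
    obtain ⟨hus, hut, huT⟩ := (mem_resDom_iff hσ).1 hu
    simp only [resChart, hgγσ _ ⟨hut, hΩdom _ hut⟩, hgβσ _ ⟨hus, hΩdom _ hus⟩,
      hkγσ _ ⟨ht, hΩdom _ hut⟩, hkβσ _ ⟨hs, hΩdom _ hus⟩, (ψ i.1).left_inv huT]
    rw [PartIsoRes.eq_mul_dilate_mul (hσ _) (hσ _) hus hut, coe_transport (hσ _) (hσ _) hs ht,
      transportOp_eq]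

theorem resDom_inter_subset (i j : I × J × J) : resDom ψ Ω σ i ∩ resDom ψ Ω σ j ⊆
    resDom ψ Ω σ i ∩ {u | u.source ∈ Ω j.2.1 ∧ u.target ∈ Ω j.2.2} :=
  fun _ hu => ⟨hu.1, hu.2.1, hu.2.2.1⟩

theorem isOpen_image_resChart_inter (hψ : ∀ α, IsSmoothUnitaryChart (ψ α))
    (hΩopen : ∀ β, IsOpen[grTopology Hp] (Ω β)) (hΩdom : ∀ β, Ω β ⊆ grDom (W β))
    (hσ : ∀ β, IsSmoothCrossSection (Ω β) (σ β)) (i j : I × J × J) :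
    IsOpen (resChart ψ W σ i '' (resDom ψ Ω σ i ∩ resDom ψ Ω σ j)) := by
  obtain ⟨τ, hτ, hτu⟩ := exists_contDiffOn_transportOp hψ hΩdom hσ i j.2.1 j.2.2
  -- The unitary group has the subspace topology, so the last condition defining the domain of `j`
  -- becomes `τ ∈ O` with `O` open. The source and target conditions alone have an open product as
  -- image.
  obtain ⟨O, hO, hOj⟩ := isOpen_induced_iff.1 (ψ j.1).open_source
  let _ := grTopology Hp
  have hopen : IsOpen (resChart ψ W σ i '' (resDom ψ Ω σ i ∩
      {u | u.source ∈ Ω j.2.1 ∧ u.target ∈ Ω j.2.2})) := by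
    rw [image_resChart_inter hσ]
    refine (isOpen_image_grChart ?_ ?_).prod ((isOpen_image_grChart ?_ ?_).prod
      (ψ i.1).open_target)
    · exact (hΩopen _).inter (hΩopen _)
    · exact inter_subset_left.trans (hΩdom _)
    · exact (hΩopen _).inter (hΩopen _)
    · exact inter_subset_left.trans (hΩdom _)
  convert! hτ.continuousOn.isOpen_inter_preimage hopen hO using 1
  ext x
  constructor
  · rintro ⟨u, hu, rfl⟩
    refine ⟨mem_image_of_mem _ (resDom_inter_subset i j hu), ?_⟩
    rw [mem_preimage, hτu u hu.1 hu.2.1 hu.2.2.1]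
    exact hOj.symm.subset hu.2.2.2.2
  · rintro ⟨⟨u, hu, rfl⟩, hx⟩
    rw [mem_preimage, hτu u hu.1 hu.2.1 hu.2.2] at hx
    exact ⟨u, ⟨hu.1, (mem_resDom_iff hσ).2 ⟨hu.2.1, hu.2.2, hOj.subset hx⟩⟩, rfl⟩

theorem exists_contDiffOn_resChart_transition (hψ : ∀ α, IsSmoothUnitaryChart (ψ α))
    (hΩdom : ∀ β, Ω β ⊆ grDom (W β)) (hσ : ∀ β, IsSmoothCrossSection (Ω β) (σ β))
    (i j : I × J × J) : ∃ g : resModel W i.2.1 i.2.2 → resModel W j.2.1 j.2.2,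
      ContDiffOn ℝ ∞ g (resChart ψ W σ i '' (resDom ψ Ω σ i ∩ resDom ψ Ω σ j)) ∧
        ∀ u ∈ resDom ψ Ω σ i ∩ resDom ψ Ω σ j,
          g (resChart ψ W σ i u) = resChart ψ W σ j u := by
  obtain ⟨τ, hτ, hτu⟩ := exists_contDiffOn_transportOp hψ hΩdom hσ i j.2.1 j.2.2
  obtain ⟨gγ, hgγ, hgγu⟩ := (isSmoothAtlas_grChart Hp).smooth_transition (W i.2.2) (W j.2.2)
  obtain ⟨gβ, hgβ, hgβu⟩ := (isSmoothAtlas_grChart Hp).smooth_transition (W i.2.1) (W j.2.1)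
  refine ⟨fun x => (gγ x.1, gβ x.2.1, extendChart (ψ j.1) (τ x)),
    ContDiffOn.prodMk ?_ (ContDiffOn.prodMk ?_ ?_), ?_⟩
  · refine hgγ.comp contDiffOn_fst ?_
    rintro _ ⟨u, hu, rfl⟩
    exact ⟨_, ⟨hΩdom _ hu.1.2.1, hΩdom _ hu.2.2.1⟩, rfl⟩
  · refine hgβ.comp contDiff_snd.fst.contDiffOn ?_
    rintro _ ⟨u, hu, rfl⟩
    exact ⟨_, ⟨hΩdom _ hu.1.1, hΩdom _ hu.2.1⟩, rfl⟩
  · refine (hψ j.1).contDiffOn_extendChart_comp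
      (hτ.mono (image_mono (resDom_inter_subset i j))) ?_
    rintro _ ⟨u, hu, rfl⟩
    exact ⟨_, hu.2.2.2.2, (hτu u hu.1 hu.2.1 hu.2.2.1).symm⟩
  · intro u hu
    simp only [hτu u hu.1 hu.2.1 hu.2.2.1, extendChart_coe]
    simp only [resChart]
    rw [hgγu _ ⟨hΩdom _ hu.1.2.1, hΩdom _ hu.2.2.1⟩, hgβu _ ⟨hΩdom _ hu.1.1, hΩdom _ hu.2.1⟩]

end ResAtlas

end Groupoid

end

/-! ### The smooth atlas and the Hausdorff property -/

theorem theorem5p3 {H : Type*} [NormedAddCommGroup H] [InnerProductSpace ℂ H] [CompleteSpace H]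
    (Hp : Submodule ℂ H) [CompleteSpace Hp]
    (hHp : ¬ FiniteDimensional ℂ Hp) (hHm : ¬ FiniteDimensional ℂ Hpᗮ)
    {I J : Type*}
    -- a smooth atlas `(V_α, ψ_α)` of the unitary group of `Hp`
    (ψ : I → OpenPartialHomeomorph (UGroup Hp) (UAlg Hp))
    (hψ : ∀ α, IsSmoothUnitaryChart (ψ α))
    (hψcover : ⋃ α, (ψ α).source = Set.univ)
    -- a family of smooth cross-sections over open sets `Ω_β`, contained in chart domains,
    -- that cover the restricted Grassmannian
    (W : J → GrRes Hp) (Ω : J → Set (GrRes Hp)) (σ : J → GrRes Hp → URes Hp)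
    (hΩopen : ∀ β, IsOpen[grTopology Hp] (Ω β))
    (hWΩ : ∀ β, W β ∈ Ω β)
    (hΩdom : ∀ β, Ω β ⊆ grDom (W β))
    (hΩcover : ⋃ β, Ω β = Set.univ)
    (hσ : ∀ β, IsSmoothCrossSection (Ω β) (σ β)) :
    -- the maps `Φ_{αβγ}` are well defined
    (∀ β, ∀ V ∈ Ω β, IsHilbertSchmidt (grChartOp (W β) V)) ∧
    (∀ β γ, ∀ u : PartIsoRes Hp, u.source ∈ Ω β → u.target ∈ Ω γ →
      transportOp (σ γ) (σ β) u ∈ unitary (Hp →L[ℂ] Hp)) ∧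
    -- they form a smooth atlas
    IsSmoothAtlas (E := fun i : I × J × J => resModel W i.2.1 i.2.2)
      (resDom ψ Ω σ) (resChart ψ W σ) ∧
    -- the model spaces are Banach spaces, and the manifold is Hausdorff
    (∀ β γ, CompleteSpace (resModel W β γ)) ∧
    @T2Space (PartIsoRes Hp) (atlasTopology (E := fun i : I × J × J => resModel W i.2.1 i.2.2)
      (resDom ψ Ω σ) (resChart ψ W σ)) := by
  have hatlas : IsSmoothAtlas (E := fun i : I × J × J => resModel W i.2.1 i.2.2)
      (resDom ψ Ω σ) (resChart ψ W σ) :=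
    { cover := iUnion_resDom hψcover hΩcover hσ
      injOn := injOn_resChart hΩdom hσ
      isOpen_image := isOpen_image_resChart_inter hψ hΩopen hΩdom hσ
      smooth_transition := exists_contDiffOn_resChart_transition hψ hΩdom hσ }
  refine ⟨fun β V _ => isHilbertSchmidt_grChartOp (W β) V,
    fun β γ u hs ht => transportOp_mem_unitary (hσ β) (hσ γ) hs ht, hatlas,
    fun β γ => inferInstance, ?_⟩
  let _ := atlasTopology (E := fun i : I × J × J => resModel W i.2.1 i.2.2)
    (resDom ψ Ω σ) (resChart ψ W σ)
  exact T2Space.of_injective_continuous (fun _ _ h => PartIsoRes.ext h)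
    ((smoothOnAtlas_coe hψ hΩdom hσ).continuous hatlas)
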